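/- Fix a vocabulary $[V]=\{1,\dots,V\}$ and a concentration parameter $\overline{\alpha}>0$. Let $\Delta^{V-1}$ be the simplex of probability vectors on $[V]$ (its elements are called topics), let $\mathcal{E}_K$ be the set of discrete probability measures $G=\sum_{k=1}^{K}\tilde\alpha_k\delta_{\theta_k}$ on $\Delta^{V-1}$ with exactly $K$ atoms ($\tilde\alpha_k>0$, $\sum_k\tilde\alpha_k=1$, $\theta_1,\dots,\theta_K$ distinct), and let $\mathcal{O}_K=\bigcup_{k=1}^{K}\mathcal{E}_k$. For $G\in\mathcal{E}_K$ and a document length $N\ge 1$, the LDA model has on $[V]^N$ the probability mass function $$p^{\mathscr L}_{G,N}(x_1,\dots,x_N)=\mathbb{E}_{q\sim\mathrm{Dir}(\overline{\alpha}\tilde\alpha_1,\dots,\overline{\alpha}\tilde\alpha_K)}\prod_{j=1}^{N}\Big(\sum_{k=1}^{K}q_k\theta_{k x_j}\Big).$$ Let $d_{TV}(p,p')=\frac12\sum_x|p(x)-p'(x)|$, and for $G=\sum_{i=1}^{K}\tilde\alpha_i\delta_{\theta_i}$, $G'=\sum_{j=1}^{K'}\tilde\alpha'_j\delta_{\theta'_j}$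 let $$W_r^r(G,G')=\inf_{q}\sum_{i=1}^{K}\sum_{j=1}^{K'}q_{ij}\|\theta_i-\theta'_j\|^r,$$ where $\|\cdot\|$ is the Euclidean norm and the infimum is over all $q_{ij}\ge 0$ with $\sum_j q_{ij}=\tilde\alpha_i$ and $\sum_i q_{ij}=\tilde\alpha'_j$. For $G_0\in\mathcal{E}_{K_0}$, say that the inverse bound of order $r$ holds on a set $\mathcal{G}$ of discrete measures at length $N$ if there is a constant $c>0$, not depending on $G$, such that $$d_{TV}(p^{\mathscr L}_{G_0,N},p^{\mathscr L}_{G,N})\ \ge\ c\,W_r^r(G,G_0)\qquad\text{for all } G\in\mathcal{G}.$$ Let $\mathfrak{N}_1(G_0)$ be the smallest $N\ge 1$ at which the inverse bound of order $1$ holds on $\mathcal{E}_{K_0}$, let $\mathfrak{N}_2(G_0,K)$ be the smallest $N\ge 1$ at which the inverse bound of order $2$ holds on $\mathcal{O}_K$, and let $\mathfrak{N}_2(G_0)$ be the smallest $N\ge 1$ at which, for every $K\ge K_0$, the inverse bound of order $2$ holds on $\mathcal{O}_K$ (with a constant that may depend on $K$); each of these is $\infty$ if there is no such $N$. **Theorem.**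 Let $G_0=\sum_{k=1}^{K_0}\tilde\alpha^0_k\delta_{\theta^0_k}\in\mathcal{E}_{K_0}$. Then: (a) $\mathfrak{N}_1(G_0)\le 2K_0-1$, and $\mathfrak{N}_2(G_0,K)\le K_0+K-1$ for every $K\ge K_0$. (b) If $\theta^0_1,\dots,\theta^0_{K_0}$ are linearly independent, then $\mathfrak{N}_1(G_0)\le 3$ and $\mathfrak{N}_2(G_0)\le 4$. (c) If $\theta^0_1,\dots,\theta^0_{K_0}$ satisfy the anchor-word condition, i.e. for every $k\in[K_0]$ there is a word $v\in[V]$ with $\theta^0_{kv}>0$ and $\theta^0_{k'v}=0$ for all $k'\ne k$, then $\mathfrak{N}_1(G_0)\le 2$. -/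

import Mathlib

open MeasureTheory ProbabilityTheory

noncomputable section

namespace LDA

/-- The Dirichlet distribution `Dir_α` with parameter `α ∈ (0, ∞)^K`: the law of
`(Y₁ / S, …, Y_K / S)`, where `Y_k ~ Gamma(α_k, 1)` are independent and `S = Y₁ + … + Y_K`. -/
def dirichlet {K : ℕ} (α : Fin K → ℝ) : Measure (Fin K → ℝ) :=
  (Measure.pi fun k => gammaMeasure (α k) 1).map fun y k => y k / ∑ l, y l

/-- A discrete (latent) probability measure `G = ∑ₖ weight k • δ_{topic k}` on the simplex of
probability vectors on a vocabulary of `V` words, with exactly `card` atoms: the weights are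
positive and sum to one, and the topics are pairwise distinct. The atoms are listed in some order;
all the notions below do not depend on that order. -/
structure MixingMeasure (V : ℕ) where
  /-- the number of atoms -/
  card : ℕ
  /-- the mixing weights -/
  weight : Fin card → ℝ
  /-- the atoms; `topic k v` is the probability of the word `v` under the topic `k` -/
  topic : Fin card → Fin V → ℝ
  weight_pos : ∀ k, 0 < weight k
  weight_sum : ∑ k, weight k = 1
  topic_mem : ∀ k, topic k ∈ stdSimplex ℝ (Fin V)
  topic_injective : Function.Injective topic

variable {V : ℕ}

/-- `ℰ_K`: the discrete probability measures with exactly `K` atoms. -/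
def exactAtoms (V K : ℕ) : Set (MixingMeasure V) := {G | G.card = K}

/-- `𝒪_K = ⋃_{1 ≤ k ≤ K} ℰ_k`: the discrete probability measures with at most `K` atoms. -/
def atMostAtoms (V K : ℕ) : Set (MixingMeasure V) := {G | 1 ≤ G.card ∧ G.card ≤ K}

/-- The probability mass function of a document of `N` words under the LDA model with
concentration parameter `a` and latent measure `G`:
`E_{q ~ Dir_α} ∏ⱼ (∑ₖ q_k θ_{k, x_j})` with `α_k = a * weight k`. -/
def ldaPMF (a : ℝ) (G : MixingMeasure V) (N : ℕ) (x : Fin N → Fin V) : ℝ :=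
  ∫ q, ∏ j, ∑ k, q k * G.topic k (x j) ∂(dirichlet fun k => a * G.weight k)

/-- The total variation distance of two probability mass functions on a finite set. -/
def dTV {X : Type*} [Fintype X] (p₁ p₂ : X → ℝ) : ℝ := (1 / 2) * ∑ x, |p₁ x - p₂ x|

/-- The couplings of two weight vectors. -/
def couplings {K K' : ℕ} (w : Fin K → ℝ) (w' : Fin K' → ℝ) : Set (Fin K → Fin K' → ℝ) :=
  {q | (∀ i j, 0 ≤ q i j) ∧ (∀ i, ∑ j, q i j = w i) ∧ ∀ j, ∑ i, q i j = w' j}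

/-- `W_r^r(G, G')`, the `r`-th power of the Wasserstein-`r` distance with respect to the Euclidean
norm. -/
def wassersteinPow (r : ℕ) (G G' : MixingMeasure V) : ℝ :=
  sInf ((fun q : Fin G.card → Fin G'.card → ℝ =>
    ∑ i, ∑ j, q i j * ‖WithLp.toLp 2 (G.topic i - G'.topic j)‖ ^ r) ''
      couplings G.weight G'.weight)

/-- The inverse bound `d_TV(p^L_{G₀,N}, p^L_{G,N}) ≳ W_r^r(G, G₀)`, for all `G ∈ 𝒢`, with a
constant which does not depend on `G`. -/
def InverseBound (a : ℝ) (G₀ : MixingMeasure V) (N r : ℕ) (𝒢 : Set (MixingMeasure V)) : Prop :=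
  ∃ c : ℝ, 0 < c ∧ ∀ G ∈ 𝒢, c * wassersteinPow r G G₀ ≤ dTV (ldaPMF a G₀ N) (ldaPMF a G N)

/-- `𝔑₁(G₀)`: the smallest document length for which the exact-fitted inverse bound holds with
`r = 1` (and `⊤` if there is none). -/
def minLength₁ (a : ℝ) (G₀ : MixingMeasure V) : ℕ∞ :=
  sInf ((fun N : ℕ => (N : ℕ∞)) ''
    {N | 1 ≤ N ∧ InverseBound a G₀ N 1 (exactAtoms V G₀.card)})

/-- `𝔑₂(G₀, K)`: the smallest document length for which the over-fitted inverse bound up to `K`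
atoms holds with `r = 2` (and `⊤` if there is none). -/
def minLength₂ (a : ℝ) (G₀ : MixingMeasure V) (K : ℕ) : ℕ∞ :=
  sInf ((fun N : ℕ => (N : ℕ∞)) ''
    {N | 1 ≤ N ∧ InverseBound a G₀ N 2 (atMostAtoms V K)})

/-- `𝔑₂(G₀)`: the smallest document length for which the over-fitted inverse bound holds with
`r = 2` for every `K ≥ K₀`, where `K₀` is the number of atoms of `G₀` (and `⊤` if there is none).
The constant in the bound may depend on `K`. -/
def minLength₂All (a : ℝ) (G₀ : MixingMeasure V) : ℕ∞ :=
  sInf ((fun N : ℕ => (N : ℕ∞)) ''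
    {N | 1 ≤ N ∧ ∀ K, G₀.card ≤ K → InverseBound a G₀ N 2 (atMostAtoms V K)})

/-- The anchor-word condition: every topic has a word with positive probability under it and
probability zero under all the other topics. -/
def AnchorWord (G₀ : MixingMeasure V) : Prop :=
  ∀ k, ∃ v, 0 < G₀.topic k v ∧ ∀ l, l ≠ k → G₀.topic l v = 0

end LDA

end

/-!
The total variation distance `D` of two document laws dominates the difference of all moments of
degree at most `N` of the latent measures, and the inverse bounds then follow by integrating
suitable test polynomials of degree at most `N`.

*From documents to moments.* The law of a document of length `N` determines the Dirichlet moments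
`E[∏ ⟨q, zⱼ⟩]` linearly. Integration by parts for the Gamma distribution (`gamma_stein`) gives the
Pólya urn recursion `dirichlet_recursion`, which expresses these moments through the moments of the
latent measure `G`. The recursion can be inverted one degree at a time
(`exists_abs_sub_mixedMoment_le`), and polarization passes from powers of one linear form to products
of linear forms, hence to all polynomials of degree at most `N` (`exists_abs_sub_integral_prod_le`,
`controlled_eval`).

*From moments to the Wasserstein distance.* Assign to every atom of `G` an atom of `G₀`. The distance
`W_r^r` is at most a constant times the cost of moving the atoms there plus the errors in the cluster
masses (`wassersteinPow_le`). The latter are controlled by test polynomials that agree with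
the indicators of the atoms of `G₀` up to an error of order `r`. So only the transport cost has to be
bounded by `D` (`inverseBound_of_clusterCost_le`), and only for small `D`.

*General atoms.* In degree `2 K₀` the product of the squared distances to the atoms of `G₀` bounds
the quadratic cost for every `G`. If `G` has at most `K₀` atoms, then, for each atom `k` of `G₀`, a
product of at most `2 K₀ - 1` affine forms which vanishes at all atoms of `G` and at all atoms of
`G₀` except `k` bounds `∏ᵢ ‖θ⁰ₖ - θᵢ‖` by `D`. This yields a matching of the atoms with a linear
error (`exists_clusterCost_le_of_card_le`).

*Linearly independent atoms.* Let `βₖ` be linear forms dual to the atoms. The distance of a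
probability vector `θ` to the nearest atom is bounded by its defects: the component outside the span
of the atoms, and the products `⟨θ, βₖ⟩ ⟨θ, βₗ⟩` with `k ≠ l`. Their squares have degree at most
four, which gives the second order bound for all `G`. If `G` has exactly `K₀` atoms and `D` is small,
then the `βₖ` are almost an orthogonal basis of `L²(G)`, so the norms of the defects in `L²(G)` are
controlled by their correlations with the `βₖ`, which have degree at most three
(`IsDualFamily.exists_integral_abs_le`). With anchor words the `βₖ` are nonnegative on the simplex,
so the products themselves, of degree two, have controlled integrals.
-/

open MeasureTheory ProbabilityTheory

noncomputable section

namespace LDA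

open Set Filter Topology

variable {V : ℕ}

/-! ### Moments of the Dirichlet distribution -/

lemma integral_gammaMeasure {α : ℝ} (hα : 0 < α) (f : ℝ → ℝ) :
    ∫ x, f x ∂gammaMeasure α 1 =
      (Real.Gamma α)⁻¹ * ∫ x in Ioi 0, x ^ (α - 1) * Real.exp (-x) * f x := by
  rw [gammaMeasure, integral_withDensity_eq_integral_toReal_smul]
  · have h0 : ∀ x ∉ Ici (0 : ℝ), (gammaPDF α 1 x).toReal • f x = 0 := by
      intro x hx
      rw [gammaPDF_of_neg (by simpa using hx)]
      simp
    rw [← setIntegral_eq_integral_of_forall_compl_eq_zero h0, integral_Ici_eq_integral_Ioi,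
      ← integral_const_mul]
    refine setIntegral_congr_fun measurableSet_Ioi fun x hx => ?_
    have hx' : (0 : ℝ) < x := hx
    have h1 : 0 ≤ 1 / Real.Gamma α * x ^ (α - 1) * Real.exp (-x) := by
      have := Real.Gamma_pos_of_pos hα
      positivity
    simp only [gammaPDF_of_nonneg hx'.le, Real.one_rpow, one_mul, smul_eq_mul]
    rw [ENNReal.toReal_ofReal h1]
    ring
  · exact (measurable_gammaPDFReal α 1).ennreal_ofReal
  · exact ae_of_all _ fun x => ENNReal.ofReal_lt_top

lemma ae_gammaMeasure_pos (α : ℝ) : ∀ᵐ x ∂gammaMeasure α 1, 0 < x := by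
  rw [gammaMeasure, ae_withDensity_iff (f := gammaPDF α 1)
    (measurable_gammaPDFReal α 1).ennreal_ofReal]
  have h : ∀ᵐ x : ℝ, x ≠ 0 := by simp [ae_iff, measure_singleton]
  filter_upwards [h] with x hx hx'
  by_contra hneg
  exact hx' (gammaPDF_of_neg (lt_of_le_of_ne (not_lt.mp hneg) hx))

lemma integrableOn_gammaDensity_mul {α M : ℝ} (hα : 0 < α) {f : ℝ → ℝ}
    (hf : AEStronglyMeasurable f (volume.restrict (Ioi 0))) (hb : ∀ x, 0 < x → |f x| ≤ M) :
    IntegrableOn (fun x => x ^ (α - 1) * Real.exp (-x) * f x) (Ioi 0) := by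
  have h := Real.GammaIntegral_convergent hα
  have h' : IntegrableOn (fun x : ℝ => x ^ (α - 1) * Real.exp (-x)) (Ioi 0) := by
    simpa only [mul_comm] using h
  exact h'.mul_bdd (c := M) hf ((ae_restrict_iff' measurableSet_Ioi).mpr <| ae_of_all _ fun x hx => hb x hx)

/-- **Integration by parts for the Gamma distribution** (Stein's identity). The derivative of the
test function `h` is written `g x / x`, because only `g` has to be bounded. -/
lemma gamma_stein {α M : ℝ} (hα : 0 < α) {h g : ℝ → ℝ}
    (hd : ∀ x, 0 < x → HasDerivAt h (g x / x) x) (hb : ∀ x, 0 < x → |h x| ≤ M)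
    (hb' : ∀ x, 0 < x → |g x| ≤ M) (hg : Measurable g) :
    ∫ x, (x - α) * h x ∂gammaMeasure α 1 = ∫ x, g x ∂gammaMeasure α 1 := by
  have hhm : AEStronglyMeasurable h (volume.restrict (Ioi 0)) := by
    refine ContinuousOn.aestronglyMeasurable (fun x hx => ?_) measurableSet_Ioi
    exact (hd x hx).continuousAt.continuousWithinAt
  have i1 : IntegrableOn (fun x => x ^ (α - 1) * Real.exp (-x) * h x) (Ioi 0) :=
    integrableOn_gammaDensity_mul hα hhm hb
  have i2 : IntegrableOn (fun x => x ^ (α + 1 - 1) * Real.exp (-x) * h x) (Ioi 0) :=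
    integrableOn_gammaDensity_mul (by linarith) hhm hb
  have i3 : IntegrableOn (fun x => x ^ (α - 1) * Real.exp (-x) * g x) (Ioi 0) :=
    integrableOn_gammaDensity_mul hα hg.aestronglyMeasurable hb'
  have hsplit : ∀ x : ℝ, 0 < x → x ^ (α + 1 - 1) = x ^ (α - 1) * x := by
    intro x hx
    rw [← Real.rpow_add_one hx.ne']
    ring_nf
  rw [integral_gammaMeasure hα, integral_gammaMeasure hα]
  congr 1
  -- the boundary terms of `x ^ α * exp (-x) * h x` vanish at `0` and at infinity
  have key : ∫ x in Ioi 0, (α * (x ^ (α - 1) * Real.exp (-x) * h x)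
      - x ^ (α + 1 - 1) * Real.exp (-x) * h x + x ^ (α - 1) * Real.exp (-x) * g x)
      = 0 - (0 : ℝ) ^ α * Real.exp (-0) * h 0 := by
    refine integral_Ioi_of_hasDerivAt_of_tendsto
      (f := fun x => x ^ α * Real.exp (-x) * h x) ?_ ?_ ?_ ?_
    · have hz : (0 : ℝ) ^ α * Real.exp (-0) * h 0 = 0 := by
        rw [Real.zero_rpow hα.ne']; ring
      rw [ContinuousWithinAt, hz]
      refine squeeze_zero_norm' (a := fun x : ℝ => x ^ α * Real.exp (-x) * M) ?_ ?_
      · filter_upwards [self_mem_nhdsWithin] with x hx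
        rcases eq_or_lt_of_le (show (0 : ℝ) ≤ x from hx) with rfl | hx
        · simp [Real.zero_rpow hα.ne']
        · rw [norm_mul, Real.norm_of_nonneg (by positivity)]
          exact mul_le_mul_of_nonneg_left (hb x hx) (by positivity)
      · have hc : ContinuousAt (fun x : ℝ => x ^ α * Real.exp (-x) * M) 0 := by
          refine ContinuousAt.mul (ContinuousAt.mul ?_ (by fun_prop)) continuousAt_const
          exact Real.continuousAt_rpow_const _ _ (Or.inr hα.le)
        have := hc.tendsto
        simp only [Real.zero_rpow hα.ne', zero_mul] at this
        exact this.mono_left nhdsWithin_le_nhds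
    · intro x hx
      have hx' : (0 : ℝ) < x := hx
      have h1 : HasDerivAt (fun x : ℝ => x ^ α) (α * x ^ (α - 1)) x :=
        Real.hasDerivAt_rpow_const (Or.inl hx'.ne')
      have h2 : HasDerivAt (fun x : ℝ => Real.exp (-x)) (-Real.exp (-x)) x := by
        simpa using (hasDerivAt_neg x).exp
      refine ((h1.mul h2).mul (hd x hx')).congr_deriv ?_
      have h3 : x ^ α = x ^ (α - 1) * x := by
        rw [← Real.rpow_add_one hx'.ne']; ring_nf
      rw [hsplit x hx']
      simp only [h3, Pi.mul_apply]
      field_simp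
      ring
    · exact ((i1.const_mul α).sub i2).add i3
    · refine squeeze_zero_norm' (a := fun x : ℝ => x ^ α * Real.exp (-(1 * x)) * M) ?_ ?_
      · filter_upwards [eventually_gt_atTop 0] with x hx
        rw [norm_mul, Real.norm_of_nonneg (by positivity), one_mul]
        exact mul_le_mul_of_nonneg_left (hb x hx) (by positivity)
      · have := (tendsto_rpow_mul_exp_neg_mul_atTop_nhds_zero α 1 one_pos).mul_const M
        simpa using this
  rw [Real.zero_rpow hα.ne'] at key
  have e1 : ∫ x in Ioi 0, (α * (x ^ (α - 1) * Real.exp (-x) * h x)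
      - x ^ (α + 1 - 1) * Real.exp (-x) * h x + x ^ (α - 1) * Real.exp (-x) * g x)
      = ∫ x in Ioi 0, ((x ^ (α - 1) * Real.exp (-x) * g x)
        - x ^ (α - 1) * Real.exp (-x) * ((x - α) * h x)) := by
    refine setIntegral_congr_fun measurableSet_Ioi fun x hx => ?_
    simp only [hsplit x hx]
    ring
  have i4 : IntegrableOn (fun x => x ^ (α - 1) * Real.exp (-x) * ((x - α) * h x)) (Ioi 0) := by
    refine (i2.sub (i1.const_mul α)).congr_fun (fun x hx => ?_) measurableSet_Ioi
    simp only [Pi.sub_apply, hsplit x hx]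
    ring
  rw [e1, integral_sub i3 i4] at key
  linarith

/-- The law of independent Gamma variables `Y₁, …, Y_K` with scale one. -/
abbrev gammaPi {K : ℕ} (α : Fin K → ℝ) : Measure (Fin K → ℝ) :=
  Measure.pi fun k => gammaMeasure (α k) 1

lemma isProbabilityMeasure_gamma_family {K : ℕ} {α : Fin K → ℝ} (hα : ∀ k, 0 < α k) (k : Fin K) :
    IsProbabilityMeasure (gammaMeasure (α k) 1) :=
  isProbabilityMeasure_gammaMeasure (hα k) one_pos

lemma isProbabilityMeasure_gammaPi {K : ℕ} {α : Fin K → ℝ} (hα : ∀ k, 0 < α k) :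
    IsProbabilityMeasure (gammaPi α) := by
  have := isProbabilityMeasure_gamma_family hα
  infer_instance

lemma ae_gammaPi_pos {K : ℕ} {α : Fin K → ℝ} (hα : ∀ k, 0 < α k) :
    ∀ᵐ y ∂gammaPi α, ∀ k, 0 < y k := by
  have := isProbabilityMeasure_gamma_family hα
  rw [ae_all_iff]
  intro k
  exact (measurePreserving_eval (fun k => gammaMeasure (α k) 1) k).quasiMeasurePreserving.ae
    (ae_gammaMeasure_pos (α k))

lemma integrable_eval_gammaPi {K : ℕ} {α : Fin K → ℝ} (hα : ∀ k, 0 < α k) (k : Fin K) :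
    Integrable (fun y => y k) (gammaPi α) := by
  have := isProbabilityMeasure_gamma_family hα
  have h : Integrable (fun x : ℝ => x) (gammaMeasure (α k) 1) := by
    have h1 := Real.GammaIntegral_convergent (s := α k + 1) (by linarith [hα k])
    rw [gammaMeasure, integrable_withDensity_iff_integrable_smul']
    rotate_left
    · exact (measurable_gammaPDFReal (α k) 1).ennreal_ofReal
    · exact ae_of_all _ fun x => ENNReal.ofReal_lt_top
    rw [← integrableOn_iff_integrable_of_support_subset (s := Ici 0), integrableOn_Ici_iff_integrableOn_Ioi]
    · refine IntegrableOn.congr_fun (h1.const_mul (Real.Gamma (α k))⁻¹) (fun x hx => ?_) measurableSet_Ioi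
      have hx' : (0 : ℝ) < x := hx
      have h2 : 0 ≤ 1 / Real.Gamma (α k) * x ^ (α k - 1) * Real.exp (-x) := by
        have := Real.Gamma_pos_of_pos (hα k)
        positivity
      have h3 : x ^ (α k + 1 - 1) = x ^ (α k - 1) * x := by
        rw [← Real.rpow_add_one hx'.ne']
        ring_nf
      simp only [gammaPDF_of_nonneg hx'.le, Real.one_rpow, one_mul, smul_eq_mul, h3]
      rw [ENNReal.toReal_ofReal h2]
      ring
    · intro x hx
      by_contra hneg
      exact hx (by simp [gammaPDF_of_neg (show x < 0 by simpa using hneg)])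
  exact integrable_comp_eval (μ := fun k => gammaMeasure (α k) 1) h

lemma integrable_of_bound_of_pos {K : ℕ} {α : Fin K → ℝ} (hα : ∀ k, 0 < α k)
    {f : (Fin K → ℝ) → ℝ} (hf : Measurable f) {M : ℝ} (hb : ∀ y, (∀ k, 0 < y k) → |f y| ≤ M) :
    Integrable f (gammaPi α) := by
  have := isProbabilityMeasure_gammaPi hα
  refine Integrable.of_bound hf.aestronglyMeasurable M ?_
  filter_upwards [ae_gammaPi_pos hα] with y hy using hb y hy

lemma integrable_eval_mul_of_bound {K : ℕ} {α : Fin K → ℝ} (hα : ∀ k, 0 < α k) (k : Fin K)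
    {f : (Fin K → ℝ) → ℝ} (hf : Measurable f) {M : ℝ} (hb : ∀ y, (∀ k, 0 < y k) → |f y| ≤ M) :
    Integrable (fun y => y k * f y) (gammaPi α) := by
  refine (integrable_eval_gammaPi hα k).mul_bdd (c := M) hf.aestronglyMeasurable ?_
  filter_upwards [ae_gammaPi_pos hα] with y hy using hb y hy

/-- Fubini's theorem, integrating over the coordinate `k` first. -/
lemma integral_gammaPi_succAbove {n : ℕ} {α : Fin (n + 1) → ℝ} (hα : ∀ k, 0 < α k)
    (k : Fin (n + 1)) {f : (Fin (n + 1) → ℝ) → ℝ} (hf : Integrable f (gammaPi α)) :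
    ∫ y, f y ∂gammaPi α = ∫ y, ∫ t, f (k.insertNth t y) ∂gammaMeasure (α k) 1
      ∂gammaPi (fun l => α (k.succAbove l)) := by
  have := isProbabilityMeasure_gamma_family hα
  have mp := (measurePreserving_piFinSuccAbove (fun k => gammaMeasure (α k) 1) k).symm
  have hint := (mp.integrable_comp_emb (MeasurableEquiv.measurableEmbedding _)).mpr hf
  rw [gammaPi, ← mp.integral_comp']
  exact integral_prod_symm _ hint

/-- Stein's identity for one coordinate of a vector of independent Gamma variables. -/
lemma gammaPi_stein {K : ℕ} {α : Fin K → ℝ} (hα : ∀ k, 0 < α k) (k : Fin K) {M : ℝ}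
    {h g : (Fin K → ℝ) → ℝ}
    (hd : ∀ y, (∀ l, 0 < y l) → HasDerivAt (fun t => h (Function.update y k t)) (g y / y k) (y k))
    (hb : ∀ y, (∀ l, 0 < y l) → |h y| ≤ M) (hb' : ∀ y, (∀ l, 0 < y l) → |g y| ≤ M)
    (hh : Measurable h) (hg : Measurable g) :
    ∫ y, (y k - α k) * h y ∂gammaPi α = ∫ y, g y ∂gammaPi α := by
  obtain ⟨n, rfl⟩ : ∃ n, K = n + 1 := ⟨K - 1, by have := k.pos; omega⟩
  have i1 : Integrable (fun y => (y k - α k) * h y) (gammaPi α) := by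
    simp only [sub_mul]
    exact (integrable_eval_mul_of_bound hα k hh hb).sub
      ((integrable_of_bound_of_pos hα hh hb).const_mul _)
  have i2 : Integrable g (gammaPi α) := integrable_of_bound_of_pos hα hg hb'
  rw [integral_gammaPi_succAbove hα k i1, integral_gammaPi_succAbove hα k i2]
  refine integral_congr_ae ?_
  filter_upwards [ae_gammaPi_pos (α := fun l => α (k.succAbove l)) fun l => hα _] with y hy
  have hpos : ∀ t : ℝ, 0 < t → ∀ l, 0 < k.insertNth (α := fun _ => ℝ) t y l := by
    intro t ht l
    rcases Fin.eq_self_or_eq_succAbove k l with rfl | ⟨j, rfl⟩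
    · simpa using ht
    · simpa using hy j
  have := gamma_stein (hα k) (M := M) (h := fun t => h (k.insertNth t y))
    (g := fun t => g (k.insertNth t y)) (fun t ht => ?_)
    (fun t ht => hb _ (hpos t ht)) (fun t ht => hb' _ (hpos t ht)) ?_
  · simpa using this
  · simpa using hd _ (hpos t ht)
  · exact hg.comp (by
      refine measurable_pi_lambda _ fun l => ?_
      rcases Fin.eq_self_or_eq_succAbove k l with rfl | ⟨j, rfl⟩
      · simpa using measurable_id'
      · simp)

/-- The normalisation `y ↦ y / ∑ y`, which maps the Gamma vector to the Dirichlet vector. -/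
def normalize {K : ℕ} (y : Fin K → ℝ) : Fin K → ℝ := fun k => y k / ∑ l, y l

lemma measurable_normalize {K : ℕ} : Measurable (normalize (K := K)) := by
  unfold normalize
  fun_prop

lemma integral_dirichlet {K : ℕ} (α : Fin K → ℝ) {F : (Fin K → ℝ) → ℝ} (hF : Continuous F) :
    ∫ q, F q ∂dirichlet α = ∫ y, F (normalize y) ∂gammaPi α :=
  integral_map measurable_normalize.aemeasurable hF.aestronglyMeasurable

lemma normalize_mem_stdSimplex {K : ℕ} [NeZero K] {y : Fin K → ℝ} (hy : ∀ k, 0 < y k) :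
    normalize y ∈ stdSimplex ℝ (Fin K) := by
  have hS : 0 < ∑ l, y l := Finset.sum_pos (fun l _ => hy l) Finset.univ_nonempty
  refine ⟨fun k => div_nonneg (hy k).le hS.le, ?_⟩
  simp only [normalize]
  rw [← Finset.sum_div, div_self hS.ne']

lemma ae_dirichlet_mem_stdSimplex {K : ℕ} [NeZero K] {α : Fin K → ℝ} (hα : ∀ k, 0 < α k) :
    ∀ᵐ q ∂dirichlet α, q ∈ stdSimplex ℝ (Fin K) := by
  have hm : MeasurableSet {q : Fin K → ℝ | q ∈ stdSimplex ℝ (Fin K)} :=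
    (isClosed_stdSimplex (𝕜 := ℝ) (ι := Fin K)).measurableSet
  refine (ae_map_iff measurable_normalize.aemeasurable hm).mpr ?_
  filter_upwards [ae_gammaPi_pos hα] with y hy using normalize_mem_stdSimplex hy

lemma isProbabilityMeasure_dirichlet {K : ℕ} {α : Fin K → ℝ} (hα : ∀ k, 0 < α k) :
    IsProbabilityMeasure (dirichlet α) := by
  have := isProbabilityMeasure_gammaPi hα
  exact Measure.isProbabilityMeasure_map measurable_normalize.aemeasurable

lemma integrable_dirichlet {K : ℕ} [NeZero K] {α : Fin K → ℝ} (hα : ∀ k, 0 < α k)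
    {F : (Fin K → ℝ) → ℝ} (hF : Continuous F) : Integrable F (dirichlet α) := by
  have := isProbabilityMeasure_dirichlet hα
  obtain ⟨M, hM⟩ := (isCompact_stdSimplex ℝ (Fin K)).exists_bound_of_continuousOn hF.continuousOn
  refine Integrable.of_bound hF.aestronglyMeasurable M ?_
  filter_upwards [ae_dirichlet_mem_stdSimplex hα] with q hq using hM q hq

lemma hasDerivAt_normalize_dotProduct {K : ℕ} [NeZero K] {y : Fin K → ℝ} (hy : ∀ k, 0 < y k)
    (k : Fin K) (z : Fin K → ℝ) :
    HasDerivAt (fun t => normalize (Function.update y k t) ⬝ᵥ z)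
      (normalize y k * (z k - normalize y ⬝ᵥ z) / y k) (y k) := by
  have hS : 0 < ∑ l, y l := Finset.sum_pos (fun l _ => hy l) Finset.univ_nonempty
  have hu := hasDerivAt_update y k (y k)
  rw [hasDerivAt_pi] at hu
  have h1 : HasDerivAt (fun t => ∑ l, Function.update y k t l) 1 (y k) := by
    have := HasDerivAt.fun_sum (u := Finset.univ) fun l _ => hu l
    simpa [Pi.single_apply] using this
  have h2 : HasDerivAt (fun t => ∑ l, Function.update y k t l * z l) (z k) (y k) := by
    have := HasDerivAt.fun_sum (u := Finset.univ) fun l _ => (hu l).mul_const (z l)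
    simpa [Pi.single_apply] using this
  have h3 := h2.fun_div h1 (by simpa using hS.ne')
  have e : ∀ y : Fin K → ℝ, normalize y ⬝ᵥ z = (∑ l, y l * z l) / ∑ l, y l := by
    intro y
    simp only [normalize, dotProduct, Finset.sum_div]
    exact Finset.sum_congr rfl fun l _ => by ring
  simp only [e]
  refine h3.congr_deriv ?_
  have hk := (hy k).ne'
  simp only [Function.update_eq_self, normalize]
  field_simp

/-- Stein's identity for the test function `⟨q, w⟩ ⟨q, z⟩ⁿ` of the normalised vector `q`. It is
homogeneous of degree zero in the Gamma vector, hence bounded. -/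
lemma stein_normalize {K : ℕ} [NeZero K] {α : Fin K → ℝ} (hα : ∀ k, 0 < α k) (k : Fin K)
    (w z : Fin K → ℝ) (n : ℕ) :
    ∫ y, (y k - α k) * ((normalize y ⬝ᵥ w) * (normalize y ⬝ᵥ z) ^ n) ∂gammaPi α =
      ∫ q, (q k * (w k - q ⬝ᵥ w) * (q ⬝ᵥ z) ^ n
        + (q ⬝ᵥ w) * (n * (q ⬝ᵥ z) ^ (n - 1) * (q k * (z k - q ⬝ᵥ z)))) ∂dirichlet α := by
  have c1 : Continuous fun q : Fin K → ℝ => (q ⬝ᵥ w) * (q ⬝ᵥ z) ^ n := by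
    unfold dotProduct; fun_prop
  have c2 : Continuous fun q : Fin K → ℝ => (q k * (w k - q ⬝ᵥ w) * (q ⬝ᵥ z) ^ n
        + (q ⬝ᵥ w) * (n * (q ⬝ᵥ z) ^ (n - 1) * (q k * (z k - q ⬝ᵥ z)))) := by
    unfold dotProduct; fun_prop
  obtain ⟨M₁, hM₁⟩ :=
    (isCompact_stdSimplex ℝ (Fin K)).exists_bound_of_continuousOn c1.continuousOn
  obtain ⟨M₂, hM₂⟩ :=
    (isCompact_stdSimplex ℝ (Fin K)).exists_bound_of_continuousOn c2.continuousOn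
  rw [integral_dirichlet α c2]
  refine gammaPi_stein hα k (M := max M₁ M₂) ?_ ?_ ?_ ?_ ?_
  · intro y hy
    have hw := hasDerivAt_normalize_dotProduct hy k w
    have hz := hasDerivAt_normalize_dotProduct hy k z
    refine (hw.fun_mul (hz.fun_pow n)).congr_deriv ?_
    simp only [Function.update_eq_self]
    ring
  · exact fun y hy => (hM₁ _ (normalize_mem_stdSimplex hy)).trans (le_max_left _ _)
  · exact fun y hy => (hM₂ _ (normalize_mem_stdSimplex hy)).trans (le_max_right _ _)
  · exact c1.measurable.comp measurable_normalize
  · exact c2.measurable.comp measurable_normalize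

/-- The Pólya urn recursion for the moments of the Dirichlet distribution. -/
theorem dirichlet_recursion {K : ℕ} [NeZero K] {α : Fin K → ℝ} (hα : ∀ k, 0 < α k)
    (w z : Fin K → ℝ) (n : ℕ) :
    (∑ k, α k + n) * ∫ q, (q ⬝ᵥ w) * (q ⬝ᵥ z) ^ n ∂dirichlet α =
      (α ⬝ᵥ w) * ∫ q, (q ⬝ᵥ z) ^ n ∂dirichlet α +
        n * ∫ q, (q ⬝ᵥ (w * z)) * (q ⬝ᵥ z) ^ (n - 1) ∂dirichlet α := by
  have cd : ∀ u : Fin K → ℝ, Continuous fun q : Fin K → ℝ => q ⬝ᵥ u := by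
    intro u; unfold dotProduct; fun_prop
  have cw := cd w
  have cz := cd z
  have czn : Continuous fun q : Fin K → ℝ => (q ⬝ᵥ z) ^ n := cz.pow n
  have cwzn : Continuous fun q : Fin K → ℝ => (q ⬝ᵥ w) * (q ⬝ᵥ z) ^ n := cw.mul czn
  have hint : ∀ {F : (Fin K → ℝ) → ℝ}, Continuous F → Integrable F (dirichlet α) :=
    fun hF => integrable_dirichlet hα hF
  have hbd : ∀ {F : (Fin K → ℝ) → ℝ}, Continuous F → ∀ k,
      Integrable (fun y => y k * F (normalize y)) (gammaPi α) := by
    intro F hF k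
    obtain ⟨M, hM⟩ :=
      (isCompact_stdSimplex ℝ (Fin K)).exists_bound_of_continuousOn hF.continuousOn
    exact integrable_eval_mul_of_bound hα k (hF.measurable.comp measurable_normalize)
      fun y hy => hM _ (normalize_mem_stdSimplex hy)
  have hbd' : ∀ {F : (Fin K → ℝ) → ℝ}, Continuous F →
      Integrable (fun y => F (normalize y)) (gammaPi α) := by
    intro F hF
    obtain ⟨M, hM⟩ :=
      (isCompact_stdSimplex ℝ (Fin K)).exists_bound_of_continuousOn hF.continuousOn
    exact integrable_of_bound_of_pos hα (hF.measurable.comp measurable_normalize)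
      fun y hy => hM _ (normalize_mem_stdSimplex hy)
  -- the identity with the linear factor `1` in place of `w`, summed against `w`
  have h1 : ∫ y, (y ⬝ᵥ w) * (normalize y ⬝ᵥ z) ^ n ∂gammaPi α
      = (α ⬝ᵥ w) * ∫ q, (q ⬝ᵥ z) ^ n ∂dirichlet α
        + n * ∫ q, (q ⬝ᵥ (w * z)) * (q ⬝ᵥ z) ^ (n - 1) ∂dirichlet α
        - n * ∫ q, (q ⬝ᵥ w) * (q ⬝ᵥ z) ^ n ∂dirichlet α := by
    have hk : ∀ k, ∫ y, y k * (normalize y ⬝ᵥ z) ^ n ∂gammaPi α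
        = α k * ∫ q, (q ⬝ᵥ z) ^ n ∂dirichlet α
          + n * ∫ q, (q k * z k) * (q ⬝ᵥ z) ^ (n - 1) ∂dirichlet α
          - n * ∫ q, q k * (q ⬝ᵥ z) ^ n ∂dirichlet α := by
      intro k
      have hs := stein_normalize hα k 1 z n
      have e1 : ∫ y, (y k - α k) * ((normalize y ⬝ᵥ 1) * (normalize y ⬝ᵥ z) ^ n) ∂gammaPi α
          = ∫ y, y k * (normalize y ⬝ᵥ z) ^ n ∂gammaPi α
            - α k * ∫ q, (q ⬝ᵥ z) ^ n ∂dirichlet α := by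
        rw [integral_dirichlet α czn, ← integral_const_mul,
          ← integral_sub (hbd czn k) ((hbd' czn).const_mul _)]
        refine integral_congr_ae ?_
        filter_upwards [ae_gammaPi_pos hα] with y hy
        rw [dotProduct_one, (normalize_mem_stdSimplex hy).2]
        ring
      have e2 : ∫ q, (q k * ((1 : Fin K → ℝ) k - q ⬝ᵥ 1) * (q ⬝ᵥ z) ^ n
          + (q ⬝ᵥ 1) * (n * (q ⬝ᵥ z) ^ (n - 1) * (q k * (z k - q ⬝ᵥ z)))) ∂dirichlet α
          = n * ∫ q, (q k * z k) * (q ⬝ᵥ z) ^ (n - 1) ∂dirichlet α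
            - n * ∫ q, q k * (q ⬝ᵥ z) ^ n ∂dirichlet α := by
        rw [← integral_const_mul, ← integral_const_mul,
          ← integral_sub ((hint (by fun_prop)).const_mul _) ((hint (by fun_prop)).const_mul _)]
        refine integral_congr_ae ?_
        filter_upwards [ae_dirichlet_mem_stdSimplex hα] with q hq
        rw [dotProduct_one, hq.2]
        rcases n with _ | n
        · simp
        · simp only [Pi.one_apply, Nat.add_sub_cancel, pow_succ]
          ring
      rw [e1, e2] at hs
      linarith
    have s1 : ∫ y, (y ⬝ᵥ w) * (normalize y ⬝ᵥ z) ^ n ∂gammaPi α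
        = ∑ k, w k * ∫ y, y k * (normalize y ⬝ᵥ z) ^ n ∂gammaPi α := by
      simp only [← integral_const_mul]
      rw [← integral_finsetSum _ fun k _ => (hbd czn k).const_mul _]
      refine integral_congr_ae (ae_of_all _ fun y => ?_)
      simp only [dotProduct, Finset.sum_mul]
      exact Finset.sum_congr rfl fun k _ => by ring
    have s2 : ∫ q, (q ⬝ᵥ (w * z)) * (q ⬝ᵥ z) ^ (n - 1) ∂dirichlet α
        = ∑ k, w k * ∫ q, (q k * z k) * (q ⬝ᵥ z) ^ (n - 1) ∂dirichlet α := by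
      simp only [← integral_const_mul]
      rw [← integral_finsetSum _ fun k _ => (hint (by fun_prop)).const_mul _]
      refine integral_congr_ae (ae_of_all _ fun y => ?_)
      simp only [dotProduct, Finset.sum_mul, Pi.mul_apply]
      exact Finset.sum_congr rfl fun k _ => by ring
    have s3 : ∫ q, (q ⬝ᵥ w) * (q ⬝ᵥ z) ^ n ∂dirichlet α
        = ∑ k, w k * ∫ q, q k * (q ⬝ᵥ z) ^ n ∂dirichlet α := by
      simp only [← integral_const_mul]
      rw [← integral_finsetSum _ fun k _ => (hint (by fun_prop)).const_mul _]
      refine integral_congr_ae (ae_of_all _ fun y => ?_)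
      simp only [dotProduct, Finset.sum_mul]
      exact Finset.sum_congr rfl fun k _ => by ring
    rw [s1, s2, s3]
    simp only [hk]
    rw [show α ⬝ᵥ w = ∑ k, α k * w k from rfl, Finset.sum_mul, Finset.mul_sum, Finset.mul_sum,
      ← Finset.sum_add_distrib, ← Finset.sum_sub_distrib]
    exact Finset.sum_congr rfl fun k _ => by ring
  -- the identity for `⟨q, w⟩ ⟨q, z⟩ⁿ`, summed over all coordinates: Euler's relation
  have h2 : ∫ y, (y ⬝ᵥ w) * (normalize y ⬝ᵥ z) ^ n ∂gammaPi α
      = (∑ k, α k) * ∫ q, (q ⬝ᵥ w) * (q ⬝ᵥ z) ^ n ∂dirichlet α := by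
    have hs := Finset.sum_congr rfl fun k (_ : k ∈ Finset.univ) => stein_normalize hα k w z n
    rw [← integral_finsetSum, ← integral_finsetSum] at hs
    rotate_left
    · exact fun k _ => hint (by fun_prop)
    · intro k _
      simp only [sub_mul]
      exact (hbd cwzn k).sub ((hbd' cwzn).const_mul _)
    have r : ∫ q, ∑ k, (q k * (w k - q ⬝ᵥ w) * (q ⬝ᵥ z) ^ n
        + (q ⬝ᵥ w) * (n * (q ⬝ᵥ z) ^ (n - 1) * (q k * (z k - q ⬝ᵥ z)))) ∂dirichlet α = 0 := by
      refine integral_eq_zero_of_ae ?_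
      filter_upwards [ae_dirichlet_mem_stdSimplex hα] with q hq
      have hv : ∀ v : Fin K → ℝ, ∑ k, q k * (v k - q ⬝ᵥ v) = 0 := by
        intro v
        simp only [mul_sub, Finset.sum_sub_distrib, ← Finset.sum_mul, hq.2, one_mul]
        exact sub_self _
      rw [Finset.sum_add_distrib, ← Finset.sum_mul, ← Finset.mul_sum, ← Finset.mul_sum, hv, hv]
      simp
    have l : ∫ y, ∑ k, (y k - α k) * ((normalize y ⬝ᵥ w) * (normalize y ⬝ᵥ z) ^ n) ∂gammaPi α
        = ∫ y, (y ⬝ᵥ w) * (normalize y ⬝ᵥ z) ^ n ∂gammaPi α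
          - (∑ k, α k) * ∫ q, (q ⬝ᵥ w) * (q ⬝ᵥ z) ^ n ∂dirichlet α := by
      rw [integral_dirichlet α cwzn, ← integral_const_mul, ← integral_sub]
      · refine integral_congr_ae ?_
        filter_upwards [ae_gammaPi_pos hα] with y hy
        have hS : 0 < ∑ l, y l := Finset.sum_pos (fun l _ => hy l) Finset.univ_nonempty
        have e : y ⬝ᵥ w = (∑ l, y l) * (normalize y ⬝ᵥ w) := by
          simp only [normalize, dotProduct, Finset.mul_sum]
          exact Finset.sum_congr rfl fun l _ => by field_simp
        rw [← Finset.sum_mul, Finset.sum_sub_distrib, e]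
        ring
      · have : (fun y => (y ⬝ᵥ w) * (normalize y ⬝ᵥ z) ^ n)
            = fun y => ∑ k, w k * (y k * (normalize y ⬝ᵥ z) ^ n) := by
          funext y
          simp only [dotProduct, Finset.sum_mul]
          exact Finset.sum_congr rfl fun k _ => by ring
        rw [this]
        exact integrable_finsetSum _ fun k _ => (hbd czn k).const_mul _
      · exact (hbd' cwzn).const_mul _
    rw [r, l] at hs
    linarith
  rw [add_mul, ← h2, h1]
  ring

/-! ### The document law controls the moments of the latent measure -/

/-- The integral `∫ f dG = ∑ₖ αₖ f(θₖ)` against a discrete latent measure. -/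
def MixingMeasure.integral (G : MixingMeasure V) (f : (Fin V → ℝ) → ℝ) : ℝ :=
  ∑ k, G.weight k * f (G.topic k)

/-- The total variation distance of the laws of a document of length `N`. -/
def docDist (a : ℝ) (G₀ : MixingMeasure V) (N : ℕ) (G : MixingMeasure V) : ℝ :=
  dTV (ldaPMF a G₀ N) (ldaPMF a G N)

lemma docDist_nonneg (a : ℝ) (G₀ : MixingMeasure V) (N : ℕ) (G : MixingMeasure V) :
    0 ≤ docDist a G₀ N G := by
  unfold docDist dTV
  positivity

lemma MixingMeasure.card_pos (G : MixingMeasure V) : 0 < G.card := by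
  by_contra h
  have h0 : G.card = 0 := by omega
  have := G.weight_sum
  have he : IsEmpty (Fin G.card) := by rw [h0]; infer_instance
  simp at this

instance (G : MixingMeasure V) : NeZero G.card := ⟨G.card_pos.ne'⟩

lemma MixingMeasure.abs_integral_le (G : MixingMeasure V) {f : (Fin V → ℝ) → ℝ} {M : ℝ}
    (h : ∀ k, |f (G.topic k)| ≤ M) : |G.integral f| ≤ M := by
  calc |G.integral f| ≤ ∑ k, |G.weight k * f (G.topic k)| := Finset.abs_sum_le_sum_abs _ _
    _ ≤ ∑ k, G.weight k * M := by
        refine Finset.sum_le_sum fun k _ => ?_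
        rw [abs_mul, abs_of_pos (G.weight_pos k)]
        exact mul_le_mul_of_nonneg_left (h k) (G.weight_pos k).le
    _ = M := by rw [← Finset.sum_mul, G.weight_sum, one_mul]

lemma abs_dotProduct_le_of_mem_stdSimplex {ι : Type*} [Fintype ι] {q z : ι → ℝ} {R : ℝ}
    (hq : q ∈ stdSimplex ℝ ι) (hz : ∀ i, |z i| ≤ R) : |q ⬝ᵥ z| ≤ R := by
  calc |q ⬝ᵥ z| ≤ ∑ i, |q i * z i| := Finset.abs_sum_le_sum_abs _ _
    _ ≤ ∑ i, q i * R := by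
        refine Finset.sum_le_sum fun i _ => ?_
        rw [abs_mul, abs_of_nonneg (hq.1 i)]
        exact mul_le_mul_of_nonneg_left (hz i) (hq.1 i)
    _ = R := by rw [← Finset.sum_mul, hq.2, one_mul]

lemma MixingMeasure.dirichlet_pos {a : ℝ} (ha : 0 < a) (G : MixingMeasure V) (k : Fin G.card) :
    0 < a * G.weight k := mul_pos ha (G.weight_pos k)

/-- Dirichlet moments of products of linear forms are linear functions of the document law. -/
lemma integral_prod_eq_sum_ldaPMF {a : ℝ} (ha : 0 < a) (G : MixingMeasure V) (N : ℕ)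
    (u : Fin N → Fin V → ℝ) :
    ∫ q, ∏ j, (q ⬝ᵥ fun k => G.topic k ⬝ᵥ u j) ∂(dirichlet fun k => a * G.weight k)
      = ∑ x : Fin N → Fin V, (∏ j, u j (x j)) * ldaPMF a G N x := by
  simp only [ldaPMF, ← integral_const_mul]
  rw [← integral_finsetSum _ fun x _ =>
    (integrable_dirichlet (G.dirichlet_pos ha) (by fun_prop)).const_mul _]
  refine integral_congr_ae (ae_of_all _ fun q => ?_)
  simp only [← Finset.prod_mul_distrib]
  rw [← Fintype.prod_sum fun (j : Fin N) (v : Fin V) => u j v * ∑ k, q k * G.topic k v]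
  refine Finset.prod_congr rfl fun j _ => ?_
  simp only [dotProduct, Finset.mul_sum]
  rw [Finset.sum_comm]
  exact Finset.sum_congr rfl fun v _ => Finset.sum_congr rfl fun k _ => by ring

/-- The mixed Dirichlet moment `E[⟨q, zⁱ⟩ ⟨q, z⟩ⁿ]`, where `z = ⟨u, θ⟩` is a linear form of the
topics. -/
def mixedMoment (a : ℝ) (G : MixingMeasure V) (u : Fin V → ℝ) (n i : ℕ) : ℝ :=
  ∫ q, (q ⬝ᵥ fun k => (G.topic k ⬝ᵥ u) ^ i) * (q ⬝ᵥ fun k => G.topic k ⬝ᵥ u) ^ n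
    ∂(dirichlet fun k => a * G.weight k)

lemma mixedMoment_zero_right {a : ℝ} (ha : 0 < a) (G : MixingMeasure V) (u : Fin V → ℝ) (n : ℕ) :
    mixedMoment a G u n 0 =
      ∫ q, (q ⬝ᵥ fun k => G.topic k ⬝ᵥ u) ^ n ∂(dirichlet fun k => a * G.weight k) := by
  refine integral_congr_ae ?_
  filter_upwards [ae_dirichlet_mem_stdSimplex (G.dirichlet_pos ha)] with q hq
  have : q ⬝ᵥ (fun k => (G.topic k ⬝ᵥ u) ^ 0) = 1 := by
    simp only [pow_zero, dotProduct, mul_one]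
    exact hq.2
  rw [this, one_mul]

lemma mixedMoment_recursion {a : ℝ} (ha : 0 < a) (G : MixingMeasure V) (u : Fin V → ℝ)
    (n i : ℕ) :
    (a + n) * mixedMoment a G u n i =
      a * G.integral (fun θ => (θ ⬝ᵥ u) ^ i) * mixedMoment a G u n 0
        + n * mixedMoment a G u (n - 1) (i + 1) := by
  have h := dirichlet_recursion (G.dirichlet_pos ha) (fun k => (G.topic k ⬝ᵥ u) ^ i)
    (fun k => G.topic k ⬝ᵥ u) n
  rw [← Finset.mul_sum, G.weight_sum, mul_one, ← mixedMoment_zero_right ha] at h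
  have e1 : (fun k => a * G.weight k) ⬝ᵥ (fun k => (G.topic k ⬝ᵥ u) ^ i)
      = a * G.integral fun θ => (θ ⬝ᵥ u) ^ i := by
    simp only [dotProduct, MixingMeasure.integral, Finset.mul_sum]
    exact Finset.sum_congr rfl fun k _ => by ring
  have e2 : ((fun k => (G.topic k ⬝ᵥ u) ^ i) * fun k => G.topic k ⬝ᵥ u)
      = fun k => (G.topic k ⬝ᵥ u) ^ (i + 1) := by
    funext k
    simp [pow_succ]
  rw [e1, e2] at h
  exact h

lemma mixedMoment_zero_left {a : ℝ} (ha : 0 < a) (G : MixingMeasure V) (u : Fin V → ℝ) (i : ℕ) :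
    mixedMoment a G u 0 i = G.integral fun θ => (θ ⬝ᵥ u) ^ i := by
  have h := mixedMoment_recursion ha G u 0 i
  have := isProbabilityMeasure_dirichlet (G.dirichlet_pos ha)
  have h1 : mixedMoment a G u 0 0 = 1 := by
    rw [mixedMoment_zero_right ha]
    simp
  rw [h1] at h
  simp only [Nat.cast_zero, add_zero, zero_mul, mul_one] at h
  exact mul_left_cancel₀ ha.ne' h

lemma abs_mixedMoment_zero_right_le {a : ℝ} (ha : 0 < a) (G : MixingMeasure V) {u : Fin V → ℝ}
    {R : ℝ} (hu : ∀ v, |u v| ≤ R) (n : ℕ) : |mixedMoment a G u n 0| ≤ R ^ n := by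
  have := isProbabilityMeasure_dirichlet (G.dirichlet_pos ha)
  rw [mixedMoment_zero_right ha, ← Real.norm_eq_abs]
  refine (norm_integral_le_of_norm_le_const (C := R ^ n) ?_).trans (by simp)
  filter_upwards [ae_dirichlet_mem_stdSimplex (G.dirichlet_pos ha)] with q hq
  rw [norm_pow]
  exact pow_le_pow_left₀ (norm_nonneg _) (abs_dotProduct_le_of_mem_stdSimplex hq fun k =>
    abs_dotProduct_le_of_mem_stdSimplex (G.topic_mem k) hu) n

/-- The moments `E[⟨q, z⟩ⁿ]` with `n ≤ N` are seen by documents of length `N`: the remaining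
`N - n` factors are `⟨q, 1⟩ = 1`. -/
lemma abs_sub_mixedMoment_zero_right_le {a : ℝ} (ha : 0 < a) (G₀ G : MixingMeasure V) {N n : ℕ}
    (hn : n ≤ N) {u : Fin V → ℝ} {R : ℝ} (hR : 1 ≤ R) (hu : ∀ v, |u v| ≤ R) :
    |mixedMoment a G u n 0 - mixedMoment a G₀ u n 0| ≤ 2 * R ^ N * docDist a G₀ N G := by
  have key : ∀ H : MixingMeasure V, mixedMoment a H u n 0 =
      ∑ x : Fin N → Fin V,
        (∏ j : Fin N, (if j.val < n then u else 1) (x j)) * ldaPMF a H N x := by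
    intro H
    rw [mixedMoment_zero_right ha,
      ← integral_prod_eq_sum_ldaPMF ha H N fun j => if j.val < n then u else 1]
    refine integral_congr_ae ?_
    filter_upwards [ae_dirichlet_mem_stdSimplex (H.dirichlet_pos ha)] with q hq
    have h1 : (q ⬝ᵥ fun k => H.topic k ⬝ᵥ (1 : Fin V → ℝ)) = 1 := by
      simp only [dotProduct_one, (H.topic_mem _).2]
      simpa [dotProduct] using hq.2
    have h2 : ∀ j : Fin N, (q ⬝ᵥ fun k => H.topic k ⬝ᵥ (if j.val < n then u else 1))
        = if j.val < n then (q ⬝ᵥ fun k => H.topic k ⬝ᵥ u) else 1 := by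
      intro j
      split_ifs
      · rfl
      · exact h1
    simp only [h2]
    rw [Finset.prod_ite, Finset.prod_const, Finset.prod_const_one, mul_one,
      Fin.card_filter_val_lt, min_eq_right hn]
  rw [key, key, ← Finset.sum_sub_distrib]
  calc |∑ x : Fin N → Fin V,
        ((∏ j : Fin N, (if j.val < n then u else 1) (x j)) * ldaPMF a G N x
          - (∏ j : Fin N, (if j.val < n then u else 1) (x j)) * ldaPMF a G₀ N x)|
      ≤ ∑ x : Fin N → Fin V, R ^ N * |ldaPMF a G₀ N x - ldaPMF a G N x| := by
        refine (Finset.abs_sum_le_sum_abs _ _).trans (Finset.sum_le_sum fun x _ => ?_)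
        rw [← mul_sub, abs_mul, abs_sub_comm (ldaPMF a G N x)]
        refine mul_le_mul_of_nonneg_right ?_ (abs_nonneg _)
        rw [Finset.abs_prod]
        refine (Finset.prod_le_prod (g := fun _ => R) (fun j _ => abs_nonneg _)
          fun j _ => ?_).trans_eq (by simp)
        split_ifs
        · exact hu _
        · simpa using hR
    _ = 2 * R ^ N * docDist a G₀ N G := by
        rw [← Finset.mul_sum, docDist, dTV]
        ring

/-- All mixed moments of total degree at most `N` are controlled by the document law. The proof
inverts the urn recursion, raising the degree `i` of the distinguished factor by one at each
step. -/
lemma exists_abs_sub_mixedMoment_le {a : ℝ} (ha : 0 < a) (G₀ : MixingMeasure V) (N : ℕ) {R : ℝ}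
    (hR : 1 ≤ R) (i : ℕ) :
    ∃ C, 0 ≤ C ∧ ∀ (G : MixingMeasure V) (u : Fin V → ℝ), (∀ v, |u v| ≤ R) → ∀ n, n + i ≤ N →
      |mixedMoment a G u n i - mixedMoment a G₀ u n i| ≤ C * docDist a G₀ N G := by
  induction i with
  | zero =>
    exact ⟨2 * R ^ N, by positivity, fun G u hu n hn =>
      abs_sub_mixedMoment_zero_right_le ha G₀ G hn hR hu⟩
  | succ i ih =>
    obtain ⟨C, hC, h⟩ := ih
    refine ⟨(a + N) * C + a * (R ^ N * C + R ^ N * (2 * R ^ N)), by positivity,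
      fun G u hu n hn => ?_⟩
    have hR0 : 0 ≤ R := by linarith
    have d0 := docDist_nonneg a G₀ N G
    have r := mixedMoment_recursion ha G u (n + 1) i
    have r₀ := mixedMoment_recursion ha G₀ u (n + 1) i
    rw [← mixedMoment_zero_left ha, Nat.add_sub_cancel] at r r₀
    have h1 := h G u hu (n + 1) (by omega)
    have h2 := h G u hu 0 (by omega)
    have h3 := abs_sub_mixedMoment_zero_right_le ha G₀ G (show n + 1 ≤ N by omega) hR hu
    have h4 : |mixedMoment a G u (n + 1) 0| ≤ R ^ N :=
      (abs_mixedMoment_zero_right_le ha G hu _).trans (pow_le_pow_right₀ hR (by omega))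
    have h5 : |mixedMoment a G₀ u 0 i| ≤ R ^ N := by
      rw [mixedMoment_zero_left ha]
      refine (G₀.abs_integral_le fun k => ?_).trans (pow_le_pow_right₀ hR (show i ≤ N by omega))
      rw [abs_pow]
      exact pow_le_pow_left₀ (abs_nonneg _)
        (abs_dotProduct_le_of_mem_stdSimplex (G₀.topic_mem k) hu) i
    have hnN : ((n + 1 : ℕ) : ℝ) ≤ N := by exact_mod_cast (show n + 1 ≤ N by omega)
    have hn1 : (1 : ℝ) ≤ ((n + 1 : ℕ) : ℝ) := by push_cast; linarith [n.cast_nonneg (α := ℝ)]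
    set c : ℝ := ((n + 1 : ℕ) : ℝ)
    set d := docDist a G₀ N G
    have e : c * (mixedMoment a G u n (i + 1) - mixedMoment a G₀ u n (i + 1))
        = (a + c) * (mixedMoment a G u (n + 1) i - mixedMoment a G₀ u (n + 1) i)
          - a * ((mixedMoment a G u 0 i - mixedMoment a G₀ u 0 i) * mixedMoment a G u (n + 1) 0
            + mixedMoment a G₀ u 0 i
              * (mixedMoment a G u (n + 1) 0 - mixedMoment a G₀ u (n + 1) 0)) := by
      linear_combination r₀ - r
    calc |mixedMoment a G u n (i + 1) - mixedMoment a G₀ u n (i + 1)|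
        ≤ c * |mixedMoment a G u n (i + 1) - mixedMoment a G₀ u n (i + 1)| :=
          le_mul_of_one_le_left (abs_nonneg _) hn1
      _ = |c * (mixedMoment a G u n (i + 1) - mixedMoment a G₀ u n (i + 1))| := by
          rw [abs_mul, abs_of_nonneg (by linarith : 0 ≤ c)]
      _ ≤ (a + c) * (C * d) + a * ((C * d) * R ^ N + R ^ N * (2 * R ^ N * d)) := by
          rw [e]
          refine (abs_sub _ _).trans (add_le_add ?_ ?_)
          · rw [abs_mul, abs_of_nonneg (by linarith : 0 ≤ a + c)]
            exact mul_le_mul_of_nonneg_left h1 (by linarith)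
          · rw [abs_mul, abs_of_pos ha]
            refine mul_le_mul_of_nonneg_left ((abs_add_le _ _).trans (add_le_add ?_ ?_)) ha.le
            · rw [abs_mul]
              exact mul_le_mul h2 h4 (abs_nonneg _) (by positivity)
            · rw [abs_mul]
              exact mul_le_mul h5 h3 (abs_nonneg _) (by positivity)
      _ ≤ (a + N) * (C * d) + a * ((C * d) * R ^ N + R ^ N * (2 * R ^ N * d)) := by
          have : 0 ≤ C * d := by positivity
          gcongr
      _ = _ := by ring

/-- A polarization formula: a positive multiple `c` of a product of `n` factors is an alternating
sum of `n`-th powers of partial sums. (The number `c`, which counts the surjections of an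
`n`-element set onto itself, is `n!`.) -/
lemma exists_polarization (n : ℕ) : ∃ c : ℕ, 1 ≤ c ∧ ∀ x : Fin n → ℝ,
    c * ∏ j, x j = ∑ T : Finset (Fin n), (-1) ^ T.card * (∑ j ∈ Tᶜ, x j) ^ n := by
  classical
  refine ⟨(Finset.univ.filter fun f : Fin n → Fin n => Function.Surjective f).card,
    Finset.card_pos.mpr ⟨id, by simp [Function.surjective_id]⟩, fun x => ?_⟩
  have h1 : ∀ T : Finset (Fin n), (-1 : ℝ) ^ T.card * (∑ j ∈ Tᶜ, x j) ^ n
      = ∑ f : Fin n → Fin n,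
        if T ⊆ (Finset.univ.image f)ᶜ then (-1) ^ T.card * ∏ j, x (f j) else 0 := by
    intro T
    rw [Finset.sum_pow', Finset.mul_sum, ← Finset.sum_filter]
    refine Finset.sum_congr ?_ fun _ _ => rfl
    ext f
    simp only [Fintype.mem_piFinset, Finset.mem_compl, Finset.mem_filter, Finset.mem_univ,
      true_and, Finset.subset_iff, Finset.mem_image, not_exists]
    exact ⟨fun h i hi j hj => h j (hj ▸ hi), fun h j hj => h hj j rfl⟩
  have h2 : ∀ f : Fin n → Fin n,
      (∑ T : Finset (Fin n),
        if T ⊆ (Finset.univ.image f)ᶜ then (-1) ^ T.card * ∏ j, x (f j) else 0)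
      = if Function.Surjective f then ∏ j, x j else 0 := by
    intro f
    have hp : ∑ T ∈ ((Finset.univ.image f)ᶜ).powerset, (-1 : ℝ) ^ T.card
        = if (Finset.univ.image f)ᶜ = ∅ then 1 else 0 := by
      have := Finset.sum_powerset_neg_one_pow_card (x := (Finset.univ.image f)ᶜ)
      have h' := congrArg (Int.cast : ℤ → ℝ) this
      push_cast at h'
      exact h'
    rw [← Finset.sum_filter, ← Finset.sum_mul]
    have hs : Finset.univ.filter (fun T : Finset (Fin n) => T ⊆ (Finset.univ.image f)ᶜ)
        = ((Finset.univ.image f)ᶜ).powerset := by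
      ext T; simp
    rw [hs, hp]
    have hiff : (Finset.univ.image f)ᶜ = ∅ ↔ Function.Surjective f := by
      rw [Finset.compl_eq_empty_iff, Finset.eq_univ_iff_forall]
      simp [Function.Surjective]
    by_cases hf : Function.Surjective f
    · rw [if_pos (hiff.mpr hf), if_pos hf, one_mul]
      exact (Finite.injective_iff_surjective.mpr hf |> fun hi =>
        (Equiv.ofBijective f ⟨hi, hf⟩).prod_comp x)
    · rw [if_neg (fun h => hf (hiff.mp h)), if_neg hf, zero_mul]
  simp only [h1]
  rw [Finset.sum_comm]
  simp only [h2]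
  rw [← Finset.sum_filter, Finset.sum_const, nsmul_eq_mul]

/-- Integrals of products of at most `N` linear forms with bounded coefficients are controlled
by the law of documents of length `N`, uniformly in the linear forms. -/
theorem exists_abs_sub_integral_prod_le {a : ℝ} (ha : 0 < a) (G₀ : MixingMeasure V) (N : ℕ)
    {R : ℝ} (hR : 1 ≤ R) :
    ∃ C, 0 ≤ C ∧ ∀ (G : MixingMeasure V) (ι : Type) [Fintype ι], Fintype.card ι ≤ N →
      ∀ u : ι → Fin V → ℝ, (∀ j v, |u j v| ≤ R) →
      |G.integral (fun θ => ∏ j, θ ⬝ᵥ u j) - G₀.integral (fun θ => ∏ j, θ ⬝ᵥ u j)|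
        ≤ C * docDist a G₀ N G := by
  have hR' : (1 : ℝ) ≤ (N + 1) * R := by nlinarith [N.cast_nonneg (α := ℝ)]
  choose C hC h using fun i => exists_abs_sub_mixedMoment_le ha G₀ N hR' i
  have hCi : ∀ n, n ≤ N → C n ≤ ∑ i ∈ Finset.range (N + 1), C i := fun n hn =>
    Finset.single_le_sum (f := C) (fun i _ => hC i) (Finset.mem_range.mpr (by omega))
  set C' := ∑ i ∈ Finset.range (N + 1), C i
  have hC' : 0 ≤ C' := Finset.sum_nonneg fun i _ => hC i
  refine ⟨2 ^ N * C', by positivity, fun G ι _ hι u hu => ?_⟩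
  set n := Fintype.card ι with hn
  have d0 := docDist_nonneg a G₀ N G
  let e := Fintype.equivFin ι
  have hre : ∀ θ : Fin V → ℝ, ∏ j, θ ⬝ᵥ u j = ∏ j : Fin n, θ ⬝ᵥ u (e.symm j) := fun θ =>
    (e.symm.prod_comp fun j => θ ⬝ᵥ u j).symm
  simp only [hre]
  obtain ⟨c, hc, hp⟩ := exists_polarization n
  have hc' : (1 : ℝ) ≤ c := by exact_mod_cast hc
  have hI : ∀ H : MixingMeasure V,
      c * H.integral (fun θ => ∏ j : Fin n, θ ⬝ᵥ u (e.symm j))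
      = ∑ T : Finset (Fin n),
        (-1) ^ T.card * H.integral fun θ => (θ ⬝ᵥ ∑ j ∈ Tᶜ, u (e.symm j)) ^ n := by
    intro H
    simp only [MixingMeasure.integral, Finset.mul_sum]
    rw [Finset.sum_comm]
    refine Finset.sum_congr rfl fun k _ => ?_
    rw [mul_left_comm, hp, Finset.mul_sum]
    refine Finset.sum_congr rfl fun T _ => ?_
    rw [dotProduct_sum]
    ring
  have hb : ∀ T : Finset (Fin n), ∀ v, |(∑ j ∈ Tᶜ, u (e.symm j)) v| ≤ (N + 1) * R := by
    intro T v
    rw [Finset.sum_apply]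
    refine (Finset.abs_sum_le_sum_abs _ _).trans
      ((Finset.sum_le_card_nsmul _ _ R fun j _ => hu _ v).trans ?_)
    rw [nsmul_eq_mul]
    refine mul_le_mul_of_nonneg_right ?_ (by linarith)
    have h1 : (Tᶜ).card ≤ n := (Finset.card_le_univ _).trans_eq (Fintype.card_fin n)
    have : ((Tᶜ).card : ℝ) ≤ N := by exact_mod_cast h1.trans hι
    linarith
  calc |G.integral (fun θ => ∏ j : Fin n, θ ⬝ᵥ u (e.symm j))
          - G₀.integral (fun θ => ∏ j : Fin n, θ ⬝ᵥ u (e.symm j))|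
      ≤ c * |G.integral (fun θ => ∏ j : Fin n, θ ⬝ᵥ u (e.symm j))
          - G₀.integral (fun θ => ∏ j : Fin n, θ ⬝ᵥ u (e.symm j))| :=
        le_mul_of_one_le_left (abs_nonneg _) hc'
    _ = |∑ T : Finset (Fin n), (-1) ^ T.card *
          (G.integral (fun θ => (θ ⬝ᵥ ∑ j ∈ Tᶜ, u (e.symm j)) ^ n)
            - G₀.integral (fun θ => (θ ⬝ᵥ ∑ j ∈ Tᶜ, u (e.symm j)) ^ n))| := by
        simp only [mul_sub, Finset.sum_sub_distrib]
        rw [← hI, ← hI, ← mul_sub, abs_mul, abs_of_nonneg (by linarith : (0 : ℝ) ≤ c)]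
    _ ≤ ∑ T : Finset (Fin n), C' * docDist a G₀ N G := by
        refine (Finset.abs_sum_le_sum_abs _ _).trans (Finset.sum_le_sum fun T _ => ?_)
        rw [abs_mul, abs_pow, abs_neg, abs_one, one_pow, one_mul, ← mixedMoment_zero_left ha,
          ← mixedMoment_zero_left ha]
        exact (h n G _ (hb T) 0 (by omega)).trans
          (mul_le_mul_of_nonneg_right (hCi n hι) d0)
    _ = 2 ^ n * C' * docDist a G₀ N G := by
        rw [Finset.sum_const, Finset.card_univ, Fintype.card_finset, Fintype.card_fin,
          nsmul_eq_mul]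
        push_cast
        ring
    _ ≤ 2 ^ N * C' * docDist a G₀ N G := by
        have : (2 : ℝ) ^ n ≤ 2 ^ N := pow_le_pow_right₀ (by norm_num) hι
        gcongr

/-- A test function is controlled if its integral against `G` is determined by the law of
documents of length `N`, with a Lipschitz bound at `G₀`. -/
def Controlled (a : ℝ) (G₀ : MixingMeasure V) (N : ℕ) (f : (Fin V → ℝ) → ℝ) : Prop :=
  ∃ C, 0 ≤ C ∧ ∀ G : MixingMeasure V, |G.integral f - G₀.integral f| ≤ C * docDist a G₀ N G

lemma MixingMeasure.integral_finsetSum (G : MixingMeasure V) {ι : Type*} (s : Finset ι)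
    (f : ι → (Fin V → ℝ) → ℝ) :
    G.integral (fun θ => ∑ i ∈ s, f i θ) = ∑ i ∈ s, G.integral (f i) := by
  simp only [MixingMeasure.integral, Finset.mul_sum]
  exact Finset.sum_comm

lemma MixingMeasure.integral_const_mul (G : MixingMeasure V) (c : ℝ) (f : (Fin V → ℝ) → ℝ) :
    G.integral (fun θ => c * f θ) = c * G.integral f := by
  simp only [MixingMeasure.integral, Finset.mul_sum]
  exact Finset.sum_congr rfl fun k _ => by ring

lemma Controlled.const_mul {a : ℝ} {G₀ : MixingMeasure V} {N : ℕ} {f : (Fin V → ℝ) → ℝ}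
    (h : Controlled a G₀ N f) (c : ℝ) : Controlled a G₀ N fun θ => c * f θ := by
  obtain ⟨C, hC, h⟩ := h
  refine ⟨|c| * C, by positivity, fun G => ?_⟩
  rw [G.integral_const_mul, G₀.integral_const_mul, ← mul_sub, abs_mul, mul_assoc]
  exact mul_le_mul_of_nonneg_left (h G) (abs_nonneg c)

lemma Controlled.finsetSum {a : ℝ} {G₀ : MixingMeasure V} {N : ℕ} {ι : Type*} (s : Finset ι)
    {f : ι → (Fin V → ℝ) → ℝ} (h : ∀ i ∈ s, Controlled a G₀ N (f i)) :
    Controlled a G₀ N fun θ => ∑ i ∈ s, f i θ := by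
  choose! C hC h using h
  refine ⟨∑ i ∈ s, C i, Finset.sum_nonneg hC, fun G => ?_⟩
  rw [G.integral_finsetSum, G₀.integral_finsetSum, ← Finset.sum_sub_distrib, Finset.sum_mul]
  exact (Finset.abs_sum_le_sum_abs _ _).trans (Finset.sum_le_sum fun i hi => h i hi G)

lemma Controlled.add {a : ℝ} {G₀ : MixingMeasure V} {N : ℕ} {f g : (Fin V → ℝ) → ℝ}
    (hf : Controlled a G₀ N f) (hg : Controlled a G₀ N g) :
    Controlled a G₀ N fun θ => f θ + g θ := by
  have := Controlled.finsetSum (Finset.univ : Finset (Fin 2)) (f := ![f, g]) (a := a) (G₀ := G₀)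
    (N := N) fun i _ => by fin_cases i <;> assumption
  simpa using this

lemma controlled_prod {a : ℝ} (ha : 0 < a) (G₀ : MixingMeasure V) {N n : ℕ} (hn : n ≤ N)
    (u : Fin n → Fin V → ℝ) : Controlled a G₀ N fun θ => ∏ j, θ ⬝ᵥ u j := by
  have hb : ∀ j v, |u j v| ≤ 1 + ‖u‖ := fun j v =>
    (norm_le_pi_norm (u j) v).trans ((norm_le_pi_norm u j).trans (by linarith))
  obtain ⟨C, hC, h⟩ := exists_abs_sub_integral_prod_le ha G₀ N
    (show 1 ≤ 1 + ‖u‖ by linarith [norm_nonneg u])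
  exact ⟨C, hC, fun G => h G (Fin n) (by simpa using hn) u hb⟩

/-- Polynomials of degree at most `N` are controlled at document length `N`. -/
theorem controlled_eval {a : ℝ} (ha : 0 < a) (G₀ : MixingMeasure V) {N : ℕ}
    {F : MvPolynomial (Fin V) ℝ} (hF : F.totalDegree ≤ N) :
    Controlled a G₀ N fun θ => MvPolynomial.eval θ F := by
  simp only [MvPolynomial.eval_eq]
  refine Controlled.finsetSum _ fun s hs => Controlled.const_mul ?_ _
  obtain ⟨C, hC, h⟩ := exists_abs_sub_integral_prod_le ha G₀ N le_rfl
  refine ⟨C, hC, fun G => ?_⟩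
  have hcard : Fintype.card (Σ v : Fin V, Fin (s v)) ≤ N := by
    rw [Fintype.card_sigma]
    simp only [Fintype.card_fin]
    have := (MvPolynomial.le_totalDegree hs).trans hF
    rwa [Finsupp.sum_fintype _ _ fun _ => rfl] at this
  have := h G (Σ v : Fin V, Fin (s v)) hcard (fun p => Pi.single p.1 1) fun p v => by
    rw [Pi.single_apply]; split_ifs <;> simp
  have e : ∀ θ : Fin V → ℝ, ∏ i ∈ s.support, θ i ^ s i
      = ∏ p : Σ v : Fin V, Fin (s v), θ ⬝ᵥ Pi.single p.1 1 := by
    intro θ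
    rw [Fintype.prod_sigma]
    simp only [dotProduct_single, mul_one, Finset.prod_const, Finset.card_univ, Fintype.card_fin]
    refine Finset.prod_subset (Finset.subset_univ _) fun v _ hv => ?_
    rw [Finsupp.notMem_support_iff.mp hv, pow_zero]
  simpa only [e] using this

/-! ### Upper bounds for the Wasserstein distance -/

lemma norm_toLp_le (x : Fin V → ℝ) : ‖WithLp.toLp 2 x‖ ≤ √V * ‖x‖ := by
  rw [EuclideanSpace.norm_eq, Real.sqrt_le_iff]
  refine ⟨by positivity, ?_⟩
  rw [mul_pow, Real.sq_sqrt (Nat.cast_nonneg V)]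
  calc ∑ i, ‖(WithLp.toLp 2 x) i‖ ^ 2 ≤ ∑ _i : Fin V, ‖x‖ ^ 2 :=
        Finset.sum_le_sum fun i _ => pow_le_pow_left₀ (norm_nonneg _) (norm_le_pi_norm x i) 2
    _ = V * ‖x‖ ^ 2 := by simp

lemma norm_sub_le_one_of_mem_stdSimplex {θ θ' : Fin V → ℝ} (h : θ ∈ stdSimplex ℝ (Fin V))
    (h' : θ' ∈ stdSimplex ℝ (Fin V)) : ‖θ - θ'‖ ≤ 1 := by
  refine (pi_norm_le_iff_of_nonneg zero_le_one).mpr fun v => ?_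
  have h1 := mem_Icc_of_mem_stdSimplex h v
  have h2 := mem_Icc_of_mem_stdSimplex h' v
  rw [Pi.sub_apply, Real.norm_eq_abs, abs_le]
  constructor <;> linarith [h1.1, h1.2, h2.1, h2.2]

/-- The mass that `G` gives to the cluster of atoms which `κ` assigns to the atom `k` of `G₀`. -/
def clusterWeight (G : MixingMeasure V) {K : ℕ} (κ : Fin G.card → Fin K) (k : Fin K) : ℝ :=
  ∑ i, if κ i = k then G.weight i else 0

/-- The transport cost of moving each atom of `G` to the atom of `G₀` chosen by `κ`. -/
def clusterCost (r : ℕ) (G G₀ : MixingMeasure V) (κ : Fin G.card → Fin G₀.card) : ℝ :=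
  ∑ i, G.weight i * ‖G.topic i - G₀.topic (κ i)‖ ^ r

lemma clusterCost_nonneg (r : ℕ) (G G₀ : MixingMeasure V) (κ : Fin G.card → Fin G₀.card) :
    0 ≤ clusterCost r G G₀ κ :=
  Finset.sum_nonneg fun i _ => mul_nonneg (G.weight_pos i).le (by positivity)

lemma clusterCost_le_one (r : ℕ) (G G₀ : MixingMeasure V) (κ : Fin G.card → Fin G₀.card) :
    clusterCost r G G₀ κ ≤ 1 := by
  rw [← G.weight_sum]
  refine Finset.sum_le_sum fun i _ => mul_le_of_le_one_right (G.weight_pos i).le ?_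
  exact pow_le_one₀ (norm_nonneg _)
    (norm_sub_le_one_of_mem_stdSimplex (G.topic_mem i) (G₀.topic_mem _))

lemma sum_weight_mul_comp (G : MixingMeasure V) {K : ℕ} (κ : Fin G.card → Fin K) (φ : Fin K → ℝ) :
    ∑ i, G.weight i * φ (κ i) = ∑ k, clusterWeight G κ k * φ k := by
  simp only [clusterWeight, Finset.sum_mul]
  rw [Finset.sum_comm]
  refine Finset.sum_congr rfl fun i _ => ?_
  simp [ite_mul]

/-- Move each atom to the atom of `G₀` chosen by `κ`, as far as the capacities of `G₀` allow, and
distribute the remaining mass proportionally to the free capacities. -/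
theorem wassersteinPow_le (r : ℕ) (G G₀ : MixingMeasure V) (κ : Fin G.card → Fin G₀.card) :
    wassersteinPow r G G₀ ≤ √V ^ r * (clusterCost r G G₀ κ
      + ∑ k, |clusterWeight G κ k - G₀.weight k|) := by
  set w' := clusterWeight G κ with hw'
  set w₀ := G₀.weight with hw₀
  let m : Fin G₀.card → ℝ := fun k => min (w' k) (w₀ k)
  let P : Fin G₀.card → ℝ := fun k => w' k - m k
  let Q : Fin G₀.card → ℝ := fun k => w₀ k - m k
  have w'nn : ∀ k, 0 ≤ w' k := fun k =>
    Finset.sum_nonneg fun i _ => by split_ifs <;> simp [(G.weight_pos i).le]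
  have w'pos : ∀ i, 0 < w' (κ i) := fun i => by
    refine lt_of_lt_of_le (G.weight_pos i) ?_
    have := Finset.single_le_sum (f := fun j => if κ j = κ i then G.weight j else 0)
      (fun j _ => by split_ifs <;> simp [(G.weight_pos j).le]) (Finset.mem_univ i)
    rw [if_pos rfl] at this
    exact this
  have mnn : ∀ k, 0 ≤ m k := fun k => le_min (w'nn k) (G₀.weight_pos k).le
  have Pnn : ∀ k, 0 ≤ P k := fun k => sub_nonneg.mpr (min_le_left _ _)
  have Qnn : ∀ k, 0 ≤ Q k := fun k => sub_nonneg.mpr (min_le_right _ _)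
  have w'sum : ∑ k, w' k = 1 := by
    have := sum_weight_mul_comp G κ fun _ => 1
    simpa [G.weight_sum] using this.symm
  set τ := ∑ k, Q k with hτ
  have hPQ : ∑ k, P k = τ := by
    simp only [hτ, P, Q, Finset.sum_sub_distrib, w'sum, hw₀, G₀.weight_sum]
  have hτ0 : 0 ≤ τ := Finset.sum_nonneg fun k _ => Qnn k
  have zeroP : τ = 0 → ∀ k, P k = 0 := fun h k =>
    (Finset.sum_eq_zero_iff_of_nonneg fun k _ => Pnn k).mp (hPQ.trans h) k (Finset.mem_univ k)
  have zeroQ : τ = 0 → ∀ k, Q k = 0 := fun h k =>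
    (Finset.sum_eq_zero_iff_of_nonneg fun k _ => Qnn k).mp h k (Finset.mem_univ k)
  have cancel : ∀ x : Fin G₀.card → ℝ, (∀ k, w' k = 0 → x k = 0) → ∀ k, w' k * (x k / w' k) = x k := by
    intro x hx k
    by_cases h : w' k = 0
    · rw [h, hx k h, zero_mul]
    · field_simp
  have cancelP := cancel P fun k h => by
    simp only [P, m, h]
    rw [min_eq_left (G₀.weight_pos k).le, sub_zero]
  have cancelM := cancel m fun k h => by
    simp only [m, h]
    exact min_eq_left (G₀.weight_pos k).le
  -- where `τ = 0`, the quotient `Q j / τ` is zero, and there is no mass left to distribute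
  let q : Fin G.card → Fin G₀.card → ℝ := fun i j =>
    (if κ i = j then G.weight i * (m (κ i) / w' (κ i)) else 0)
      + G.weight i * (P (κ i) / w' (κ i)) * (Q j / τ)
  have hq : q ∈ couplings G.weight G₀.weight := by
    refine ⟨fun i j => ?_, fun i => ?_, fun j => ?_⟩
    · have h1 := (G.weight_pos i).le
      refine add_nonneg ?_ ?_
      · split_ifs
        · exact mul_nonneg h1 (div_nonneg (mnn _) (w'nn _))
        · exact le_rfl
      · exact mul_nonneg (mul_nonneg h1 (div_nonneg (Pnn _) (w'nn _))) (div_nonneg (Qnn _) hτ0)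
    · simp only [q, Finset.sum_add_distrib, Finset.sum_ite_eq, Finset.mem_univ, if_true,
        ← Finset.mul_sum, ← Finset.sum_div, ← hτ]
      have := (w'pos i).ne'
      have hmP : m (κ i) + P (κ i) = w' (κ i) := add_sub_cancel _ _
      by_cases h : τ = 0
      · rw [zeroP h, add_zero] at hmP
        rw [hmP, zeroP h, div_self this]
        ring
      · rw [div_self h, mul_one, ← mul_add, ← add_div, hmP, div_self this, mul_one]
    · have e1 : ∑ i, (if κ i = j then G.weight i * (m (κ i) / w' (κ i)) else 0) = m j := by
        have := sum_weight_mul_comp G κ fun k => if k = j then m k / w' k else 0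
        simp only [mul_ite, mul_zero, ← hw', Finset.sum_ite_eq', Finset.mem_univ, if_true,
          cancelM] at this
        exact this
      have e2 : ∑ i, G.weight i * (P (κ i) / w' (κ i)) = τ := by
        rw [sum_weight_mul_comp G κ fun k => P k / w' k]
        simp only [← hw', cancelP, hPQ]
      simp only [q, Finset.sum_add_distrib, ← Finset.sum_mul, e1, e2]
      by_cases h : τ = 0
      · have := zeroQ h j
        rw [h, zero_mul, add_zero]
        simp only [Q] at this
        linarith
      · rw [mul_div_cancel₀ _ h]
        exact add_sub_cancel _ _
  have hbdd : BddBelow ((fun q : Fin G.card → Fin G₀.card → ℝ =>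
      ∑ i, ∑ j, q i j * ‖WithLp.toLp 2 (G.topic i - G₀.topic j)‖ ^ r) ''
      couplings G.weight G₀.weight) := by
    refine ⟨0, ?_⟩
    rintro _ ⟨q, hq, rfl⟩
    exact Finset.sum_nonneg fun i _ => Finset.sum_nonneg fun j _ =>
      mul_nonneg (hq.1 i j) (by positivity)
  refine (csInf_le hbdd ⟨q, hq, rfl⟩).trans ?_
  have hB : (0 : ℝ) ≤ √V ^ r := by positivity
  have cost : ∀ i j, ‖WithLp.toLp 2 (G.topic i - G₀.topic j)‖ ^ r
      ≤ √V ^ r * ‖G.topic i - G₀.topic j‖ ^ r := fun i j => by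
    rw [← mul_pow]
    exact pow_le_pow_left₀ (norm_nonneg _) (norm_toLp_le _) r
  have cost1 : ∀ i j, ‖WithLp.toLp 2 (G.topic i - G₀.topic j)‖ ^ r ≤ √V ^ r := fun i j =>
    (cost i j).trans (mul_le_of_le_one_right hB (pow_le_one₀ (norm_nonneg _)
      (norm_sub_le_one_of_mem_stdSimplex (G.topic_mem i) (G₀.topic_mem j))))
  calc ∑ i, ∑ j, q i j * ‖WithLp.toLp 2 (G.topic i - G₀.topic j)‖ ^ r
      ≤ ∑ i, (G.weight i * (√V ^ r * ‖G.topic i - G₀.topic (κ i)‖ ^ r)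
          + G.weight i * (P (κ i) / w' (κ i)) * √V ^ r) := by
        refine Finset.sum_le_sum fun i _ => ?_
        have h1 := (G.weight_pos i).le
        have h2 : 0 ≤ G.weight i * (P (κ i) / w' (κ i)) :=
          mul_nonneg h1 (div_nonneg (Pnn _) (w'nn _))
        simp only [q, add_mul, Finset.sum_add_distrib, ite_mul, zero_mul, Finset.sum_ite_eq,
          Finset.mem_univ, if_true]
        refine add_le_add ?_ ?_
        · refine mul_le_mul ?_ (cost i _) (by positivity) h1
          refine mul_le_of_le_one_right h1 (div_le_one_of_le₀ (min_le_left _ _) (w'nn _))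
        · calc ∑ j, G.weight i * (P (κ i) / w' (κ i)) * (Q j / τ)
                * ‖WithLp.toLp 2 (G.topic i - G₀.topic j)‖ ^ r
              ≤ ∑ j, G.weight i * (P (κ i) / w' (κ i)) * (Q j / τ) * √V ^ r :=
                Finset.sum_le_sum fun j _ => mul_le_mul_of_nonneg_left (cost1 i j)
                  (mul_nonneg h2 (div_nonneg (Qnn _) hτ0))
            _ = G.weight i * (P (κ i) / w' (κ i)) * (τ / τ) * √V ^ r := by
                rw [← Finset.sum_mul, ← Finset.mul_sum, ← Finset.sum_div, ← hτ]
            _ ≤ G.weight i * (P (κ i) / w' (κ i)) * √V ^ r := by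
                refine mul_le_mul_of_nonneg_right ?_ hB
                exact mul_le_of_le_one_right h2 (div_self_le_one τ)
    _ = √V ^ r * (clusterCost r G G₀ κ + ∑ k, P k) := by
        rw [Finset.sum_add_distrib, ← Finset.sum_mul, sum_weight_mul_comp G κ fun k => P k / w' k]
        simp only [← hw', cancelP, clusterCost, mul_add, Finset.mul_sum]
        rw [mul_comm, Finset.mul_sum]
        congr 1
        exact Finset.sum_congr rfl fun i _ => by ring
    _ ≤ _ := by
        refine mul_le_mul_of_nonneg_left (add_le_add le_rfl (Finset.sum_le_sum fun k _ => ?_)) hB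
        simp only [P, m]
        rcases le_total (w' k) (w₀ k) with h | h
        · rw [min_eq_left h, sub_self]; exact abs_nonneg _
        · rw [min_eq_right h]; exact le_abs_self _

/-- If controlled functions `gₖ` agree with the indicator of the atom `k` at all atoms of `G₀`, up
to an error of order `r` in the distance to the atom, then they control the cluster masses, and the
Wasserstein distance is bounded by the transport cost to the clusters. -/
theorem exists_wassersteinPow_le {a : ℝ} {G₀ : MixingMeasure V} {N r : ℕ} (hr : r ≠ 0)
    {g : Fin G₀.card → (Fin V → ℝ) → ℝ} (hg : ∀ k, Controlled a G₀ N (g k)) {B : ℝ}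
    (hB : ∀ θ ∈ stdSimplex ℝ (Fin V), ∀ k l,
      |g k θ - if l = k then 1 else 0| ≤ B * ‖θ - G₀.topic l‖ ^ r) :
    ∃ C, 0 ≤ C ∧ ∀ (G : MixingMeasure V) (κ : Fin G.card → Fin G₀.card),
      wassersteinPow r G G₀ ≤ C * (clusterCost r G G₀ κ + docDist a G₀ N G) := by
  choose c hc h using hg
  refine ⟨√V ^ r * (1 + ∑ k, (|B| + c k)), ?_, fun G κ => ?_⟩
  · have : 0 ≤ ∑ k, (|B| + c k) := Finset.sum_nonneg fun k _ => add_nonneg (abs_nonneg _) (hc k)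
    positivity
  have d0 := docDist_nonneg a G₀ N G
  have c0 := clusterCost_nonneg r G G₀ κ
  have hk : ∀ k, |clusterWeight G κ k - G₀.weight k|
      ≤ (|B| + c k) * (clusterCost r G G₀ κ + docDist a G₀ N G) := by
    intro k
    have e0 : G₀.integral (g k) = G₀.weight k := by
      have : ∀ l, g k (G₀.topic l) = if l = k then 1 else 0 := fun l => by
        have := hB (G₀.topic l) (G₀.topic_mem l) k l
        rw [sub_self, norm_zero, zero_pow hr, mul_zero] at this
        exact sub_eq_zero.mp (abs_nonpos_iff.mp this)
      simp [MixingMeasure.integral, this]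
    have e1 : |G.integral (g k) - clusterWeight G κ k| ≤ |B| * clusterCost r G G₀ κ := by
      have : G.integral (g k) - clusterWeight G κ k
          = ∑ i, G.weight i * (g k (G.topic i) - if κ i = k then 1 else 0) := by
        simp [MixingMeasure.integral, clusterWeight, mul_sub]
      rw [this, clusterCost, Finset.mul_sum]
      refine (Finset.abs_sum_le_sum_abs _ _).trans (Finset.sum_le_sum fun i _ => ?_)
      rw [abs_mul, abs_of_pos (G.weight_pos i), mul_left_comm]
      refine mul_le_mul_of_nonneg_left ((hB _ (G.topic_mem i) k (κ i)).trans ?_)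
        (G.weight_pos i).le
      exact mul_le_mul_of_nonneg_right (le_abs_self B) (by positivity)
    have e2 := h k G
    rw [e0] at e2
    have e3 : |clusterWeight G κ k - G₀.weight k|
        ≤ |G.integral (g k) - clusterWeight G κ k| + |G.integral (g k) - G₀.weight k| := by
      rw [abs_sub_comm (G.integral (g k)) (clusterWeight G κ k)]
      exact abs_sub_le _ _ _
    nlinarith [abs_nonneg B, hc k, mul_nonneg (abs_nonneg B) d0, mul_nonneg (hc k) c0]
  refine (wassersteinPow_le r G G₀ κ).trans ?_
  rw [mul_assoc]
  refine mul_le_mul_of_nonneg_left ?_ (by positivity)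
  rw [add_mul, one_mul, Finset.sum_mul]
  exact add_le_add (by linarith) (Finset.sum_le_sum fun k _ => hk k)

/-- The inverse bound follows if, for documents close to those of `G₀`, the atoms can be assigned
to atoms of `G₀` at a cost controlled by the document law. -/
theorem inverseBound_of_clusterCost_le {a : ℝ} {G₀ : MixingMeasure V} {N r : ℕ} (hr : r ≠ 0)
    {g : Fin G₀.card → (Fin V → ℝ) → ℝ} (hg : ∀ k, Controlled a G₀ N (g k)) {B : ℝ}
    (hB : ∀ θ ∈ stdSimplex ℝ (Fin V), ∀ k l,
      |g k θ - if l = k then 1 else 0| ≤ B * ‖θ - G₀.topic l‖ ^ r)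
    {𝒢 : Set (MixingMeasure V)} {δ C : ℝ} (hδ : 0 < δ)
    (hC : ∀ G ∈ 𝒢, docDist a G₀ N G < δ →
      ∃ κ : Fin G.card → Fin G₀.card, clusterCost r G G₀ κ ≤ C * docDist a G₀ N G) :
    InverseBound a G₀ N r 𝒢 := by
  obtain ⟨A, hA, h⟩ := exists_wassersteinPow_le hr hg hB
  have hD : ∀ G ∈ 𝒢, wassersteinPow r G G₀ ≤ A * ((|C| + δ⁻¹ + 1) * docDist a G₀ N G) := by
    intro G hG
    have d0 := docDist_nonneg a G₀ N G
    have hi : 0 < δ⁻¹ := inv_pos.mpr hδ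
    have hC0 := abs_nonneg C
    rcases lt_or_ge (docDist a G₀ N G) δ with hd | hd
    · obtain ⟨κ, hκ⟩ := hC G hG hd
      refine (h G κ).trans (mul_le_mul_of_nonneg_left ?_ hA)
      have : C * docDist a G₀ N G ≤ |C| * docDist a G₀ N G :=
        mul_le_mul_of_nonneg_right (le_abs_self C) d0
      nlinarith [mul_nonneg hi.le d0]
    · refine (h G fun _ => 0).trans (mul_le_mul_of_nonneg_left ?_ hA)
      have h1 := clusterCost_le_one r G G₀ fun _ => 0
      have h2 : 1 ≤ δ⁻¹ * docDist a G₀ N G := by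
        rw [inv_mul_eq_div]
        exact (one_le_div hδ).mpr hd
      nlinarith [mul_nonneg hC0 d0]
  have hpos : 0 < A * (|C| + δ⁻¹ + 1) + 1 := by positivity
  refine ⟨(A * (|C| + δ⁻¹ + 1) + 1)⁻¹, inv_pos.mpr hpos, fun G hG => ?_⟩
  rw [inv_mul_le_iff₀ hpos]
  have d0 := docDist_nonneg a G₀ N G
  calc wassersteinPow r G G₀ ≤ A * ((|C| + δ⁻¹ + 1) * docDist a G₀ N G) := hD G hG
    _ ≤ (A * (|C| + δ⁻¹ + 1) + 1) * docDist a G₀ N G := by nlinarith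

/-! ### Interpolation at general atoms -/

lemma exists_pos_le_one_forall_le {ι : Type*} [Finite ι] {f : ι → ℝ} (hf : ∀ i, 0 < f i) :
    ∃ s, 0 < s ∧ s ≤ 1 ∧ ∀ i, s ≤ f i := by
  cases isEmpty_or_nonempty ι
  · exact ⟨1, one_pos, le_rfl, fun i => isEmptyElim i⟩
  · obtain ⟨i₀, h⟩ := Finite.exists_min f
    exact ⟨min 1 (f i₀), lt_min one_pos (hf i₀), min_le_left _ _, fun i =>
      (min_le_right _ _).trans (h i)⟩

/-- The atoms of a latent measure are separated in the supremum norm. -/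
lemma MixingMeasure.exists_separation (G₀ : MixingMeasure V) :
    ∃ s, 0 < s ∧ s ≤ 1 ∧ ∀ k l, k ≠ l → s ≤ ‖G₀.topic k - G₀.topic l‖ := by
  obtain ⟨s, hs, hs1, h⟩ := exists_pos_le_one_forall_le
    (f := fun p : {p : Fin G₀.card × Fin G₀.card // p.1 ≠ p.2} =>
      ‖G₀.topic p.1.1 - G₀.topic p.1.2‖)
    fun p => norm_pos_iff.mpr (sub_ne_zero.mpr (G₀.topic_injective.ne p.2))
  exact ⟨s, hs, hs1, fun k l hkl => h ⟨(k, l), hkl⟩⟩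

lemma MixingMeasure.vocabulary_nonempty (G₀ : MixingMeasure V) : Nonempty (Fin V) := by
  by_contra h
  rw [not_nonempty_iff] at h
  have := (G₀.topic_mem 0).2
  simp at this

/-- The supremum norm of a vector is attained at some coordinate. -/
lemma exists_abs_eq_norm [Nonempty (Fin V)] (x : Fin V → ℝ) : ∃ v, |x v| = ‖x‖ := by
  obtain ⟨v, hv⟩ := Finite.exists_max fun v => |x v|
  exact ⟨v, le_antisymm (norm_le_pi_norm x v)
    ((pi_norm_le_iff_of_nonneg (abs_nonneg _)).mpr fun w => hv w)⟩

/-- First order expansion of the product `∏ (1 + eₗ)`. -/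
lemma exists_abs_prod_one_add_sub_le {ι : Type*} (s : Finset ι) {T : ℝ} (hT : 0 ≤ T) :
    ∃ A, 0 ≤ A ∧ ∀ (e : ι → ℝ) (t : ℝ), 0 ≤ t → t ≤ 1 → (∀ l ∈ s, |e l| ≤ T * t) →
      |∏ l ∈ s, (1 + e l) - (1 + ∑ l ∈ s, e l)| ≤ A * t ^ 2 := by
  classical
  induction s using Finset.induction_on with
  | empty => exact ⟨0, le_rfl, fun e t _ _ _ => by simp⟩
  | insert i s hi ih =>
    obtain ⟨A, hA, h⟩ := ih
    refine ⟨T * (s.card * T) + (1 + T) * A, by positivity, fun e t ht ht1 he => ?_⟩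
    have h1 := h e t ht ht1 fun l hl => he l (Finset.mem_insert_of_mem hl)
    have h2 := he i (Finset.mem_insert_self i s)
    have h3 : |∑ l ∈ s, e l| ≤ s.card * (T * t) := by
      refine (Finset.abs_sum_le_sum_abs _ _).trans
        ((Finset.sum_le_card_nsmul _ _ (T * t) fun l hl =>
          he l (Finset.mem_insert_of_mem hl)).trans_eq (nsmul_eq_mul _ _))
    rw [Finset.prod_insert hi, Finset.sum_insert hi]
    have e1 : (1 + e i) * ∏ l ∈ s, (1 + e l) - (1 + (e i + ∑ l ∈ s, e l))
        = e i * ∑ l ∈ s, e l + (1 + e i) * (∏ l ∈ s, (1 + e l) - (1 + ∑ l ∈ s, e l)) := by ring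
    have h4 : |1 + e i| ≤ 1 + T := by
      refine (abs_add_le _ _).trans ?_
      rw [abs_one]
      have : T * t ≤ T := mul_le_of_le_one_right hT ht1
      linarith
    rw [e1]
    calc _ ≤ |e i| * |∑ l ∈ s, e l|
          + |1 + e i| * |∏ l ∈ s, (1 + e l) - (1 + ∑ l ∈ s, e l)| := by
          rw [← abs_mul, ← abs_mul]; exact abs_add_le _ _
      _ ≤ (T * t) * (s.card * (T * t)) + (1 + T) * (A * t ^ 2) := by gcongr
      _ = _ := by ring

/-- The square of a product `∏ (1 + eₗ)`, corrected to first order by the factor `1 - 2 ∑ eₗ`,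
is one up to second order. -/
lemma exists_abs_sq_prod_mul_sub_one_le {ι : Type*} (s : Finset ι) {T : ℝ} (hT : 0 ≤ T) :
    ∃ A, 0 ≤ A ∧ ∀ (e : ι → ℝ) (t : ℝ), 0 ≤ t → t ≤ 1 → (∀ l ∈ s, |e l| ≤ T * t) →
      |(∏ l ∈ s, (1 + e l)) ^ 2 * (1 - 2 * ∑ l ∈ s, e l) - 1| ≤ A * t ^ 2 := by
  obtain ⟨A, hA, h⟩ := exists_abs_prod_one_add_sub_le s hT
  set S : ℝ := s.card * T
  have hS : 0 ≤ S := by positivity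
  refine ⟨S ^ 2 * (3 + 2 * S) + A * (2 + 2 * S + A) * (1 + 2 * S), by positivity,
    fun e t ht ht1 he => ?_⟩
  have h1 := h e t ht ht1 he
  have h3 : |∑ l ∈ s, e l| ≤ S * t := by
    refine (Finset.abs_sum_le_sum_abs _ _).trans
      ((Finset.sum_le_card_nsmul _ _ (T * t) he).trans_eq ?_)
    rw [nsmul_eq_mul, mul_assoc]
  set σ := ∑ l ∈ s, e l
  set ρ := ∏ l ∈ s, (1 + e l) - (1 + σ) with hρ
  have hprod : ∏ l ∈ s, (1 + e l) = 1 + σ + ρ := by rw [hρ]; ring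
  have hσ : |σ| ≤ S := h3.trans (mul_le_of_le_one_right hS ht1)
  have hρ' : |ρ| ≤ A := h1.trans (mul_le_of_le_one_right hA (pow_le_one₀ ht ht1))
  have e1 : (1 + σ + ρ) ^ 2 * (1 - 2 * σ) - 1
      = σ ^ 2 * (-3 - 2 * σ) + ρ * (2 + 2 * σ + ρ) * (1 - 2 * σ) := by ring
  obtain ⟨hσ1, hσ2⟩ := abs_le.mp hσ
  obtain ⟨hρ1, hρ2⟩ := abs_le.mp hρ'
  have b1 : |-3 - 2 * σ| ≤ 3 + 2 * S := by rw [abs_le]; constructor <;> linarith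
  have b2 : |2 + 2 * σ + ρ| ≤ 2 + 2 * S + A := by rw [abs_le]; constructor <;> linarith
  have b3 : |1 - 2 * σ| ≤ 1 + 2 * S := by rw [abs_le]; constructor <;> linarith
  rw [hprod, e1]
  clear_value ρ σ S
  calc _ ≤ |σ| ^ 2 * |-3 - 2 * σ| + |ρ| * |2 + 2 * σ + ρ| * |1 - 2 * σ| := by
        rw [← abs_pow, ← abs_mul, ← abs_mul, ← abs_mul]; exact abs_add_le _ _
    _ ≤ (S * t) ^ 2 * (3 + 2 * S) + (A * t ^ 2) * (2 + 2 * S + A) * (1 + 2 * S) := by gcongr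
    _ = _ := by ring

lemma totalDegree_X_sub_C_le (v : Fin V) (c : ℝ) :
    (MvPolynomial.X v - MvPolynomial.C c : MvPolynomial (Fin V) ℝ).totalDegree ≤ 1 :=
  (MvPolynomial.totalDegree_sub_C_le _ _).trans (MvPolynomial.totalDegree_X v).le

/-- Hermite interpolation: polynomials of degree `2 K₀ - 1` which agree with the indicators of the
atoms of `G₀` to first order at every atom. -/
theorem exists_hermite {a : ℝ} (ha : 0 < a) (G₀ : MixingMeasure V) {N : ℕ}
    (hN : 2 * G₀.card - 1 ≤ N) :
    ∃ (g : Fin G₀.card → (Fin V → ℝ) → ℝ) (B : ℝ), 0 ≤ B ∧ (∀ k, Controlled a G₀ N (g k)) ∧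
      ∀ θ ∈ stdSimplex ℝ (Fin V), ∀ k l,
        |g k θ - if l = k then 1 else 0| ≤ B * ‖θ - G₀.topic l‖ ^ 2 := by
  classical
  have := G₀.vocabulary_nonempty
  obtain ⟨s, hs, hs1, hsep⟩ := G₀.exists_separation
  choose v hv using fun k l => exists_abs_eq_norm (G₀.topic k - G₀.topic l)
  set T := s⁻¹
  have hT0 : 0 ≤ T := by positivity
  have hT1 : 1 ≤ T := (one_le_inv₀ hs).mpr hs1
  let c : Fin G₀.card → Fin G₀.card → ℝ := fun k l =>
    G₀.topic k (v k l) - G₀.topic l (v k l)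
  have hc : ∀ k l, k ≠ l → s ≤ |c k l| := fun k l h => (hsep k l h).trans_eq (hv k l).symm
  have hc0 : ∀ k l, k ≠ l → c k l ≠ 0 := fun k l h => abs_pos.mp (hs.trans_le (hc k l h))
  let e : Fin G₀.card → Fin G₀.card → (Fin V → ℝ) → ℝ := fun k l θ =>
    (c k l)⁻¹ * (θ (v k l) - G₀.topic k (v k l))
  have hdiv : ∀ k l, k ≠ l → ∀ (θ θ' : Fin V → ℝ),
      |(c k l)⁻¹ * (θ (v k l) - θ' (v k l))| ≤ T * ‖θ - θ'‖ := fun k l h θ θ' => by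
    rw [abs_mul, abs_inv]
    refine mul_le_mul (inv_anti₀ hs (hc k l h)) (norm_le_pi_norm (θ - θ') _) (abs_nonneg _) hT0
  have he : ∀ k l, k ≠ l → ∀ θ, |e k l θ| ≤ T * ‖θ - G₀.topic k‖ := fun k l h θ =>
    hdiv k l h θ (G₀.topic k)
  have h1e : ∀ k l, k ≠ l → ∀ θ, |1 + e k l θ| ≤ T * ‖θ - G₀.topic l‖ := fun k l h θ => by
    have : 1 + e k l θ = (c k l)⁻¹ * (θ (v k l) - G₀.topic l (v k l)) := by
      have := hc0 k l h
      simp only [e]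
      field_simp
      simp only [c]
      ring
    rw [this]
    exact hdiv k l h θ (G₀.topic l)
  choose A hA hAb using fun k : Fin G₀.card =>
    exists_abs_sq_prod_mul_sub_one_le (Finset.univ.erase k) hT0
  have hAs : ∀ k, A k ≤ ∑ k, A k := fun k =>
    Finset.single_le_sum (fun k _ => hA k) (Finset.mem_univ k)
  set A' := ∑ k, A k
  have hA' : 0 ≤ A' := Finset.sum_nonneg fun k _ => hA k
  set B' := (T ^ G₀.card * T) ^ 2 * (1 + 2 * (G₀.card * T))
  refine ⟨fun k θ => (∏ l ∈ Finset.univ.erase k, (1 + e k l θ)) ^ 2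
    * (1 - 2 * ∑ l ∈ Finset.univ.erase k, e k l θ), A' + B', by positivity, fun k => ?_,
    fun θ hθ k l => ?_⟩
  · let E : Fin G₀.card → MvPolynomial (Fin V) ℝ := fun l =>
      MvPolynomial.C (c k l)⁻¹ * (MvPolynomial.X (v k l) - MvPolynomial.C (G₀.topic k (v k l)))
    have hE : ∀ l, (E l).totalDegree ≤ 1 := fun l =>
      (MvPolynomial.totalDegree_mul _ _).trans (by
        rw [MvPolynomial.totalDegree_C, zero_add]
        exact totalDegree_X_sub_C_le _ _)
    have hF : ((∏ l ∈ Finset.univ.erase k, (1 + E l)) ^ 2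
        * (1 - MvPolynomial.C 2 * ∑ l ∈ Finset.univ.erase k, E l)).totalDegree ≤ N := by
      refine (MvPolynomial.totalDegree_mul _ _).trans ((Nat.add_le_add
        ((MvPolynomial.totalDegree_pow _ _).trans (Nat.mul_le_mul_left 2
          ((MvPolynomial.totalDegree_finsetProd _ _).trans
            (Finset.sum_le_card_nsmul _ _ 1 fun l _ => ?_))))
        ((MvPolynomial.totalDegree_sub _ _).trans (max_le (c := 1) ?_ ?_))).trans ?_)
      · refine (MvPolynomial.totalDegree_add _ _).trans (max_le ?_ (hE l))
        rw [MvPolynomial.totalDegree_one]; exact zero_le_one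
      · rw [MvPolynomial.totalDegree_one]; exact zero_le_one
      · refine (MvPolynomial.totalDegree_mul _ _).trans ?_
        rw [MvPolynomial.totalDegree_C, zero_add]
        exact MvPolynomial.totalDegree_finsetSum_le fun l _ => hE l
      · rw [Finset.card_erase_of_mem (Finset.mem_univ k), Finset.card_univ, Fintype.card_fin]
        have := G₀.card_pos
        simp only [smul_eq_mul, mul_one]
        omega
    convert controlled_eval ha G₀ hF using 2 with θ
    simp [E, e]
  · have ht1 := norm_sub_le_one_of_mem_stdSimplex hθ (G₀.topic_mem l)
    have ht0 := norm_nonneg (θ - G₀.topic l)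
    set t := ‖θ - G₀.topic l‖
    by_cases hlk : l = k
    · rw [if_pos hlk]
      subst hlk
      refine (hAb l (fun j => e l j θ) t ht0 ht1 fun j hj =>
        he l j (Finset.ne_of_mem_erase hj).symm θ).trans ?_
      have := hAs l
      have hB' : 0 ≤ B' := by positivity
      gcongr
      linarith
    · rw [if_neg hlk, sub_zero, abs_mul, abs_pow, Finset.abs_prod]
      have hbound : ∀ j ∈ Finset.univ.erase k, |e k j θ| ≤ T := fun j hj =>
        (he k j (Finset.ne_of_mem_erase hj).symm θ).trans (mul_le_of_le_one_right hT0
          (norm_sub_le_one_of_mem_stdSimplex hθ (G₀.topic_mem k)))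
      have hcard : ((Finset.univ.erase k).card : ℝ) ≤ G₀.card := by
        exact_mod_cast (Finset.card_le_univ _).trans_eq (Fintype.card_fin _)
      have p1 : |1 - 2 * ∑ j ∈ Finset.univ.erase k, e k j θ| ≤ 1 + 2 * (G₀.card * T) := by
        refine (abs_sub _ _).trans ?_
        rw [abs_one, abs_mul, abs_two]
        have : |∑ j ∈ Finset.univ.erase k, e k j θ| ≤ G₀.card * T :=
          (Finset.abs_sum_le_sum_abs _ _).trans ((Finset.sum_le_card_nsmul _ _ T hbound).trans (by
            rw [nsmul_eq_mul]; exact mul_le_mul_of_nonneg_right hcard hT0))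
        linarith
      have p2 : ∏ j ∈ Finset.univ.erase k, |1 + e k j θ| ≤ T ^ G₀.card * T * t := by
        have hl : l ∈ Finset.univ.erase k := Finset.mem_erase.mpr ⟨hlk, Finset.mem_univ l⟩
        rw [← Finset.mul_prod_erase _ _ hl]
        have q1 := h1e k l (Ne.symm hlk) θ
        have q2 : ∏ j ∈ (Finset.univ.erase k).erase l, |1 + e k j θ| ≤ T ^ G₀.card := by
          refine (Finset.prod_le_prod (g := fun _ => T) (fun j _ => abs_nonneg _)
            fun j hj => ?_).trans ?_
          · exact (h1e k j (Finset.ne_of_mem_erase (Finset.mem_of_mem_erase hj)).symm θ).trans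
              (mul_le_of_le_one_right hT0
                (norm_sub_le_one_of_mem_stdSimplex hθ (G₀.topic_mem j)))
          · rw [Finset.prod_const]
            exact pow_le_pow_right₀ hT1 ((Finset.card_le_univ _).trans_eq (Fintype.card_fin _))
        calc _ ≤ (T * t) * T ^ G₀.card :=
              mul_le_mul q1 q2 (Finset.prod_nonneg fun j _ => abs_nonneg _) (by positivity)
          _ = _ := by ring
      calc _ ≤ (T ^ G₀.card * T * t) ^ 2 * (1 + 2 * (G₀.card * T)) := by
            refine mul_le_mul (pow_le_pow_left₀ (Finset.prod_nonneg fun j _ => abs_nonneg _) p2 2)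
              p1 (abs_nonneg _) (by positivity)
        _ = B' * t ^ 2 := by ring
        _ ≤ (A' + B') * t ^ 2 := by
            gcongr
            linarith

/-- The product of the squared distances to the atoms of `G₀` has degree `2 K₀` and dominates the
squared distance to the nearest atom. -/
theorem inverseBound_two_of_two_mul_card_le {a : ℝ} (ha : 0 < a) (G₀ : MixingMeasure V) {N : ℕ}
    (hN : 2 * G₀.card ≤ N) (𝒢 : Set (MixingMeasure V)) : InverseBound a G₀ N 2 𝒢 := by
  classical
  have := G₀.vocabulary_nonempty
  obtain ⟨g, B, hB, hg, hgB⟩ := exists_hermite ha G₀ (show 2 * G₀.card - 1 ≤ N by omega)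
  obtain ⟨s, hs, hs1, hsep⟩ := G₀.exists_separation
  let f : (Fin V → ℝ) → ℝ := fun θ => ∏ k, ∑ v, (θ v - G₀.topic k v) ^ 2
  have hf : Controlled a G₀ N f := by
    have hF : (∏ k, ∑ v, (MvPolynomial.X v - MvPolynomial.C (G₀.topic k v)) ^ 2 :
        MvPolynomial (Fin V) ℝ).totalDegree ≤ N := by
      refine (MvPolynomial.totalDegree_finsetProd _ _).trans
        ((Finset.sum_le_card_nsmul _ _ 2 fun k _ => ?_).trans ?_)
      · refine MvPolynomial.totalDegree_finsetSum_le fun v _ => ?_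
        exact (MvPolynomial.totalDegree_pow _ _).trans
          (Nat.mul_le_mul_left 2 (totalDegree_X_sub_C_le _ _))
      · rw [Finset.card_univ, Fintype.card_fin, smul_eq_mul]
        omega
    convert controlled_eval ha G₀ hF using 2 with θ
    simp [f]
  obtain ⟨C, hC, hfC⟩ := hf
  have hf0 : G₀.integral f = 0 := by
    refine Finset.sum_eq_zero fun k _ => ?_
    have : f (G₀.topic k) = 0 := Finset.prod_eq_zero (Finset.mem_univ k) (by simp)
    rw [this, mul_zero]
  have hsq : ∀ x : Fin V → ℝ, ‖x‖ ^ 2 ≤ ∑ v, x v ^ 2 := fun x => by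
    obtain ⟨v, hv⟩ := exists_abs_eq_norm x
    rw [← hv, sq_abs]
    exact Finset.single_le_sum (f := fun v => x v ^ 2) (fun v _ => sq_nonneg _)
      (Finset.mem_univ v)
  set m : ℝ := ((s / 2) ^ 2) ^ G₀.card with hm
  have hm0 : 0 < m := by positivity
  have hlow : ∀ θ, ∃ κ, m * ‖θ - G₀.topic κ‖ ^ 2 ≤ f θ := fun θ => by
    obtain ⟨κ, hκ⟩ := Finite.exists_min fun k => ‖θ - G₀.topic k‖
    refine ⟨κ, ?_⟩
    simp only [f]
    rw [← Finset.mul_prod_erase _ _ (Finset.mem_univ κ), mul_comm m]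
    refine mul_le_mul (hsq (θ - G₀.topic κ)) ?_ hm0.le
      (Finset.sum_nonneg fun v _ => sq_nonneg _)
    calc m ≤ ((s / 2) ^ 2) ^ (Finset.univ.erase κ).card :=
          pow_le_pow_of_le_one (by positivity) (pow_le_one₀ (by positivity) (by linarith))
            ((Finset.card_le_univ _).trans_eq (Fintype.card_fin _))
      _ ≤ _ := by
          rw [← Finset.prod_const]
          refine Finset.prod_le_prod (fun k _ => by positivity) fun k hk => ?_
          refine le_trans (pow_le_pow_left₀ (by positivity) ?_ 2) (hsq (θ - G₀.topic k))
          have h1 := hsep κ k (Finset.ne_of_mem_erase hk).symm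
          have h2 := norm_sub_le_norm_sub_add_norm_sub (G₀.topic κ) θ (G₀.topic k)
          rw [norm_sub_rev (G₀.topic κ) θ] at h2
          have h3 : ‖θ - G₀.topic κ‖ ≤ ‖θ - G₀.topic k‖ := hκ k
          linarith
  choose κ hκ using hlow
  refine inverseBound_of_clusterCost_le two_ne_zero hg hgB one_pos (C := m⁻¹ * C)
    fun G _ _ => ⟨fun i => κ (G.topic i), ?_⟩
  have h := hfC G
  rw [hf0, sub_zero] at h
  rw [mul_assoc, le_inv_mul_iff₀ hm0]
  refine le_trans ?_ ((le_abs_self _).trans h)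
  rw [clusterCost, MixingMeasure.integral, Finset.mul_sum]
  refine Finset.sum_le_sum fun i _ => ?_
  rw [mul_left_comm]
  exact mul_le_mul_of_nonneg_left (hκ _) (G.weight_pos i).le

/-- If `G` has at most `K₀` atoms, then every atom of `G₀` is close to some atom of `G`: the product
of affine forms that vanishes at all atoms of `G` and at all other atoms of `G₀` has degree at most
`2 K₀ - 1`. -/
theorem exists_prod_norm_sub_le {a : ℝ} (ha : 0 < a) (G₀ : MixingMeasure V) {N : ℕ}
    (hN : 2 * G₀.card - 1 ≤ N) :
    ∃ C, 0 ≤ C ∧ ∀ G : MixingMeasure V, G.card ≤ G₀.card → ∀ k,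
      ∏ i, ‖G₀.topic k - G.topic i‖ ≤ C * docDist a G₀ N G := by
  classical
  have := G₀.vocabulary_nonempty
  obtain ⟨C, hC, h⟩ := exists_abs_sub_integral_prod_le ha G₀ N one_le_two
  obtain ⟨s, hs, hs1, hsep⟩ := G₀.exists_separation
  obtain ⟨ω, hω, -, hω'⟩ := exists_pos_le_one_forall_le G₀.weight_pos
  have hm0 : 0 < ω * s ^ G₀.card := by positivity
  refine ⟨(ω * s ^ G₀.card)⁻¹ * C, by positivity, fun G hG k => ?_⟩
  choose v hv using fun i => exists_abs_eq_norm (G₀.topic k - G.topic i)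
  choose w hw using fun l => exists_abs_eq_norm (G₀.topic k - G₀.topic l)
  -- the affine form `θ_v - c` is the linear form with these coefficients on the simplex
  let aff : Fin V → ℝ → Fin V → ℝ := fun v c => Pi.single v 1 - c • 1
  have haff : ∀ θ ∈ stdSimplex ℝ (Fin V), ∀ v c, θ ⬝ᵥ aff v c = θ v - c := fun θ hθ v c => by
    simp only [aff, dotProduct_sub, dotProduct_smul, dotProduct_one, dotProduct_single, hθ.2]
    simp
  have haffb : ∀ v c, c ∈ Icc (0 : ℝ) 1 → ∀ x, |aff v c x| ≤ 2 := fun v c hc x => by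
    simp only [aff, Pi.sub_apply, Pi.single_apply, Pi.smul_apply, Pi.one_apply, smul_eq_mul,
      mul_one]
    obtain ⟨h0, h1⟩ := hc
    split_ifs <;> rw [abs_le] <;> constructor <;> linarith
  let u : Fin G.card ⊕ {l : Fin G₀.card // l ≠ k} → Fin V → ℝ :=
    Sum.elim (fun i => aff (v i) (G.topic i (v i)))
      fun l => aff (w l) (G₀.topic l (w l))
  have hcard : Fintype.card (Fin G.card ⊕ {l : Fin G₀.card // l ≠ k}) ≤ N := by
    rw [Fintype.card_sum, Fintype.card_subtype_compl, Fintype.card_subtype_eq, Fintype.card_fin,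
      Fintype.card_fin]
    omega
  have hu : ∀ j x, |u j x| ≤ 2 := by
    rintro (i | l) x
    · exact haffb _ _ (mem_Icc_of_mem_stdSimplex (G.topic_mem i) _) x
    · exact haffb _ _ (mem_Icc_of_mem_stdSimplex (G₀.topic_mem l) _) x
  have key := h G _ hcard u hu
  have hprod : ∀ θ ∈ stdSimplex ℝ (Fin V), ∏ j, θ ⬝ᵥ u j = (∏ i, (θ (v i) - G.topic i (v i)))
      * ∏ l : {l : Fin G₀.card // l ≠ k}, (θ (w l) - G₀.topic l (w l)) := fun θ hθ => by
    rw [Fintype.prod_sum_type]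
    simp only [u, Sum.elim_inl, Sum.elim_inr, haff θ hθ]
  have hG0 : G.integral (fun θ => ∏ j, θ ⬝ᵥ u j) = 0 := by
    refine Finset.sum_eq_zero fun i _ => ?_
    beta_reduce
    rw [hprod _ (G.topic_mem i), Finset.prod_eq_zero (Finset.mem_univ i) (sub_self _), zero_mul,
      mul_zero]
  have hG₀ : G₀.integral (fun θ => ∏ j, θ ⬝ᵥ u j) = G₀.weight k *
      ((∏ i, (G₀.topic k (v i) - G.topic i (v i)))
      * ∏ l : {l : Fin G₀.card // l ≠ k}, (G₀.topic k (w l) - G₀.topic l (w l))) := by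
    rw [MixingMeasure.integral, Finset.sum_eq_single k, hprod _ (G₀.topic_mem k)]
    · intro l _ hl
      rw [hprod _ (G₀.topic_mem l),
        Finset.prod_eq_zero (Finset.mem_univ (⟨l, hl⟩ : {l : Fin G₀.card // l ≠ k}))
          (sub_self _), mul_zero, mul_zero]
    · simp
  rw [hG0, hG₀, zero_sub, abs_neg, abs_mul, abs_mul, Finset.abs_prod, Finset.abs_prod,
    abs_of_pos (G₀.weight_pos k)] at key
  simp only [← Pi.sub_apply, hv, hw] at key
  rw [mul_assoc, le_inv_mul_iff₀ hm0]
  refine le_trans ?_ key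
  have hp : s ^ G₀.card ≤ ∏ l : {l : Fin G₀.card // l ≠ k}, ‖G₀.topic k - G₀.topic l‖ := by
    refine (pow_le_pow_of_le_one hs.le hs1 ((Fintype.card_subtype_le fun l => l ≠ k).trans_eq
      (Fintype.card_fin _))).trans ?_
    rw [← Finset.card_univ, ← Finset.prod_const]
    exact Finset.prod_le_prod (fun _ _ => hs.le) fun l _ => hsep k l (Ne.symm l.2)
  have hq : 0 ≤ ∏ i, ‖G₀.topic k - G.topic i‖ := Finset.prod_nonneg fun i _ => norm_nonneg _
  calc ω * s ^ G₀.card * ∏ i, ‖G₀.topic k - G.topic i‖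
      = ω * ((∏ i, ‖G₀.topic k - G.topic i‖) * s ^ G₀.card) := by ring
    _ ≤ _ := by
      refine mul_le_mul (hω' k) (mul_le_mul_of_nonneg_left hp hq) (by positivity)
        (G₀.weight_pos k).le

/-- Documents of length `2 K₀ - 1` match the atoms of a latent measure with at most `K₀` atoms to
those of `G₀`, with a linear error bound. -/
theorem exists_clusterCost_le_of_card_le {a : ℝ} (ha : 0 < a) (G₀ : MixingMeasure V) {N : ℕ}
    (hN : 2 * G₀.card - 1 ≤ N) :
    ∃ δ C : ℝ, 0 < δ ∧ ∀ G : MixingMeasure V, G.card ≤ G₀.card → docDist a G₀ N G < δ →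
      ∃ κ : Fin G.card → Fin G₀.card, clusterCost 1 G G₀ κ ≤ C * docDist a G₀ N G := by
  classical
  obtain ⟨C, hC, h⟩ := exists_prod_norm_sub_le ha G₀ hN
  obtain ⟨s, hs, hs1, hsep⟩ := G₀.exists_separation
  -- with radius `s / 3` an atom of `G` is near at most one atom of `G₀`, and at distance at least
  -- `s / 3` from all the others
  set ρ := s / 3 with hρ
  have hρ0 : 0 < ρ := by positivity
  have hρ1 : ρ ≤ 1 := by linarith
  refine ⟨ρ ^ G₀.card / (C + 1), (ρ ^ G₀.card)⁻¹ * C, by positivity, fun G hG hd => ?_⟩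
  have hsmall : C * docDist a G₀ N G < ρ ^ G₀.card := by
    rw [lt_div_iff₀ (by positivity)] at hd
    nlinarith [docDist_nonneg a G₀ N G]
  have hpow : ∀ t : Finset (Fin G.card), ρ ^ G₀.card ≤ ρ ^ t.card := fun t =>
    pow_le_pow_of_le_one hρ0.le hρ1
      (((Finset.card_le_univ _).trans_eq (Fintype.card_fin _)).trans hG)
  have hnear : ∀ k, ∃ i, ‖G₀.topic k - G.topic i‖ < ρ := fun k => by
    by_contra! hcon
    have : ρ ^ G₀.card ≤ ∏ i, ‖G₀.topic k - G.topic i‖ := by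
      refine (hpow Finset.univ).trans ?_
      rw [← Finset.prod_const]
      exact Finset.prod_le_prod (fun _ _ => hρ0.le) fun i _ => hcon i
    linarith [h G hG k]
  choose τ hτ using hnear
  have hfar : ∀ k l, l ≠ k → ρ ≤ ‖G₀.topic k - G.topic (τ l)‖ := fun k l hlk => by
    have h1 := hsep k l (Ne.symm hlk)
    have h2 := norm_sub_le_norm_sub_add_norm_sub (G₀.topic k) (G.topic (τ l)) (G₀.topic l)
    have h3 := hτ l
    rw [norm_sub_rev] at h3
    linarith
  have hinj : Function.Injective τ := fun k l hkl => by
    by_contra hne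
    have := hfar k l (Ne.symm hne)
    rw [← hkl] at this
    linarith [hτ k]
  have hcard : Fintype.card (Fin G₀.card) = Fintype.card (Fin G.card) := by
    have := Fintype.card_le_of_injective τ hinj
    simp only [Fintype.card_fin] at this ⊢
    omega
  have hbij : Function.Bijective τ := (Fintype.bijective_iff_injective_and_card τ).mpr ⟨hinj, hcard⟩
  let e := Equiv.ofBijective τ hbij
  -- in the product over the atoms of `G`, all factors but the matched one are bounded below
  have hclose : ∀ k, ‖G₀.topic k - G.topic (τ k)‖
      ≤ (ρ ^ G₀.card)⁻¹ * C * docDist a G₀ N G := fun k => by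
    rw [mul_assoc, le_inv_mul_iff₀ (by positivity)]
    refine le_trans ?_ (h G hG k)
    rw [← Finset.mul_prod_erase _ _ (Finset.mem_univ (τ k)), mul_comm]
    refine mul_le_mul_of_nonneg_left ((hpow (Finset.univ.erase (τ k))).trans ?_) (norm_nonneg _)
    rw [← Finset.prod_const]
    refine Finset.prod_le_prod (fun _ _ => hρ0.le) fun i hi => ?_
    obtain ⟨l, rfl⟩ := hbij.2 i
    exact hfar k l fun hlk => Finset.ne_of_mem_erase hi (by rw [hlk])
  refine ⟨e.symm, ?_⟩
  calc clusterCost 1 G G₀ e.symm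
      ≤ ∑ i, G.weight i * ((ρ ^ G₀.card)⁻¹ * C * docDist a G₀ N G) := by
        refine Finset.sum_le_sum fun i _ => mul_le_mul_of_nonneg_left ?_ (G.weight_pos i).le
        have := hclose (e.symm i)
        have hi : τ (e.symm i) = i := e.apply_symm_apply i
        rwa [hi, norm_sub_rev, ← pow_one ‖G.topic i - _‖] at this
    _ = _ := by rw [← Finset.sum_mul, G.weight_sum, one_mul]

lemma clusterCost_two_le_one (G G₀ : MixingMeasure V) (κ : Fin G.card → Fin G₀.card) :
    clusterCost 2 G G₀ κ ≤ clusterCost 1 G G₀ κ :=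
  Finset.sum_le_sum fun i _ => mul_le_mul_of_nonneg_left
    (pow_le_pow_of_le_one (norm_nonneg _)
      (norm_sub_le_one_of_mem_stdSimplex (G.topic_mem i) (G₀.topic_mem _)) one_le_two)
    (G.weight_pos i).le

theorem inverseBound_one_of_card_le {a : ℝ} (ha : 0 < a) (G₀ : MixingMeasure V) :
    InverseBound a G₀ (2 * G₀.card - 1) 1 {G | G.card ≤ G₀.card} := by
  obtain ⟨g, B, hB, hg, hgB⟩ := exists_hermite ha G₀ le_rfl
  obtain ⟨δ, C, hδ, h⟩ := exists_clusterCost_le_of_card_le ha G₀ le_rfl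
  refine inverseBound_of_clusterCost_le one_ne_zero hg (B := B) (fun θ hθ k l => ?_) hδ h
  refine (hgB θ hθ k l).trans (mul_le_mul_of_nonneg_left ?_ hB)
  exact pow_le_pow_of_le_one (norm_nonneg _)
    (norm_sub_le_one_of_mem_stdSimplex hθ (G₀.topic_mem l)) one_le_two

theorem inverseBound_two_of_card_le {a : ℝ} (ha : 0 < a) (G₀ : MixingMeasure V) :
    InverseBound a G₀ (2 * G₀.card - 1) 2 {G | G.card ≤ G₀.card} := by
  obtain ⟨g, B, hB, hg, hgB⟩ := exists_hermite ha G₀ le_rfl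
  obtain ⟨δ, C, hδ, h⟩ := exists_clusterCost_le_of_card_le ha G₀ le_rfl
  refine inverseBound_of_clusterCost_le two_ne_zero hg hgB hδ (C := C) fun G hG hd => ?_
  obtain ⟨κ, hκ⟩ := h G hG hd
  exact ⟨κ, (clusterCost_two_le_one G G₀ κ).trans hκ⟩

/-! ### Linearly independent atoms -/

/-- Linear forms `θ ↦ ⟨θ, βₖ⟩` dual to the atoms of `G₀`. -/
def IsDualFamily (G₀ : MixingMeasure V) (β : Fin G₀.card → Fin V → ℝ) : Prop :=
  ∀ k l, G₀.topic l ⬝ᵥ β k = if l = k then 1 else 0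

lemma exists_isDualFamily {G₀ : MixingMeasure V} (h : LinearIndependent ℝ G₀.topic) :
    ∃ β, IsDualFamily G₀ β := by
  obtain ⟨M, hM⟩ := LinearMap.exists_leftInverse_of_injective
    (Fintype.linearCombination ℝ G₀.topic)
    (LinearMap.ker_eq_bot.mpr (linearIndependent_iff_injective_fintypeLinearCombination.mp h))
  refine ⟨fun k v => M (Pi.single v 1) k, fun k l => ?_⟩
  have h1 : M (G₀.topic l) = Pi.single l 1 := by
    have := LinearMap.congr_fun hM (Pi.single l 1)
    simpa using this
  have h2 : G₀.topic l ⬝ᵥ (fun v => M (Pi.single v 1) k) = M (G₀.topic l) k := by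
    conv_rhs => rw [pi_eq_sum_univ' (G₀.topic l)]
    simp [dotProduct, Finset.sum_apply]
  rw [h2, h1, Pi.single_apply]
  simp [eq_comm]

/-- Under the anchor-word condition the dual linear forms can be taken nonnegative: rescaled
probabilities of the anchor words. -/
lemma AnchorWord.exists_isDualFamily {G₀ : MixingMeasure V} (h : AnchorWord G₀) :
    ∃ β, IsDualFamily G₀ β ∧ ∀ k, ∀ θ ∈ stdSimplex ℝ (Fin V), 0 ≤ θ ⬝ᵥ β k := by
  choose v hv hv' using h
  refine ⟨fun k => Pi.single (v k) (G₀.topic k (v k))⁻¹, fun k l => ?_, fun k θ hθ => ?_⟩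
  · rw [dotProduct_single]
    split_ifs with hlk
    · rw [hlk, mul_inv_cancel₀ (hv k).ne']
    · rw [hv' k l hlk, zero_mul]
  · rw [dotProduct_single]
    exact mul_nonneg (hθ.1 _) (inv_nonneg.mpr (hv k).le)

/-- The functions which vanish at the atoms of `G₀` and measure how far a point is from them: the
coordinates of the component of `θ` outside the span of the atoms, and the products
`⟨θ, βₖ⟩ ⟨θ, βₗ⟩` with `k ≠ l`. -/
def defect (G₀ : MixingMeasure V) (β : Fin G₀.card → Fin V → ℝ) :
    Fin V ⊕ {p : Fin G₀.card × Fin G₀.card // p.1 ≠ p.2} → (Fin V → ℝ) → ℝ :=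
  Sum.elim (fun v θ => θ ⬝ᵥ (Pi.single v 1 - ∑ k, G₀.topic k v • β k))
    fun p θ => (θ ⬝ᵥ β p.1.1) * (θ ⬝ᵥ β p.1.2)

lemma defect_inl (G₀ : MixingMeasure V) (β : Fin G₀.card → Fin V → ℝ) (v : Fin V)
    (θ : Fin V → ℝ) :
    defect G₀ β (Sum.inl v) θ = θ v - ∑ k, G₀.topic k v * (θ ⬝ᵥ β k) := by
  simp [defect, dotProduct_sub, dotProduct_sum, dotProduct_smul]

lemma IsDualFamily.defect_topic {G₀ : MixingMeasure V} {β : Fin G₀.card → Fin V → ℝ}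
    (hβ : IsDualFamily G₀ β) (j) (k : Fin G₀.card) : defect G₀ β j (G₀.topic k) = 0 := by
  rcases j with v | ⟨⟨l, l'⟩, hl⟩
  · rw [defect_inl]
    simp [hβ _ k]
  · simp only [defect, Sum.elim_inr, hβ _ k]
    by_cases h : k = l
    · rw [if_neg (show k ≠ l' from fun h' => hl (h.symm.trans h')), mul_zero]
    · rw [if_neg h, zero_mul]

/-- The distance of a probability vector to the nearest atom of `G₀` is bounded by its defects.
Since the forms `⟨θ, βₖ⟩` sum to nearly one, one of them is bounded below, and its products with the
others bound those. -/
lemma exists_norm_sub_le_sum_defect (G₀ : MixingMeasure V) (β : Fin G₀.card → Fin V → ℝ) :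
    ∃ C, 0 ≤ C ∧ ∀ θ ∈ stdSimplex ℝ (Fin V), ∃ κ,
      ‖θ - G₀.topic κ‖ ≤ C * ∑ j, |defect G₀ β j θ| := by
  classical
  obtain ⟨n, hn⟩ : ∃ n : ℝ, n = G₀.card := ⟨_, rfl⟩
  have hn0 : 0 < n := by rw [hn]; exact_mod_cast G₀.card_pos
  refine ⟨4 * n + 2, by positivity, fun θ hθ => ?_⟩
  set P := ∑ v, |defect G₀ β (Sum.inl v) θ| with hP
  set E := ∑ p : {p : Fin G₀.card × Fin G₀.card // p.1 ≠ p.2}, |defect G₀ β (Sum.inr p) θ| with hE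
  have hP0 : 0 ≤ P := Finset.sum_nonneg fun v _ => abs_nonneg _
  have hE0 : 0 ≤ E := Finset.sum_nonneg fun v _ => abs_nonneg _
  rw [Fintype.sum_sum_type, ← hP, ← hE]
  set b : Fin G₀.card → ℝ := fun k => θ ⬝ᵥ β k
  have hdecomp : ∀ v, θ v = ∑ k, G₀.topic k v * b k + defect G₀ β (Sum.inl v) θ := fun v => by
    rw [defect_inl]; ring
  have hsum : ∑ k, b k + ∑ v, defect G₀ β (Sum.inl v) θ = 1 := by
    rw [← hθ.2, Finset.sum_congr rfl fun v _ => hdecomp v, Finset.sum_add_distrib,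
      Finset.sum_comm]
    congr 1
    refine Finset.sum_congr rfl fun k _ => ?_
    rw [← Finset.sum_mul, (G₀.topic_mem k).2, one_mul]
  have hPsum : |∑ v, defect G₀ β (Sum.inl v) θ| ≤ P := Finset.abs_sum_le_sum_abs _ _
  rcases le_or_gt (1 / 2) P with hhalf | hhalf
  · refine ⟨0, (norm_sub_le_one_of_mem_stdSimplex hθ (G₀.topic_mem 0)).trans ?_⟩
    nlinarith [mul_nonneg hn0.le hP0, mul_nonneg hn0.le hE0]
  · obtain ⟨κ, -, hκ⟩ : ∃ κ ∈ Finset.univ, 1 / (2 * n) ≤ b κ := by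
      refine Finset.exists_le_of_sum_le Finset.univ_nonempty ?_
      rw [Finset.sum_const, Finset.card_univ, Fintype.card_fin, nsmul_eq_mul, ← hn]
      have h1 : n * (1 / (2 * n)) = 1 / 2 := by field_simp
      rw [h1]
      linarith [(abs_le.mp hPsum).2]
    set L := ∑ l ∈ Finset.univ.erase κ, |b l| with hL
    have hLE : L ≤ 2 * n * E := by
      have h1 : ∑ l ∈ Finset.univ.erase κ, |b κ * b l| ≤ E := by
        have : ∑ l ∈ Finset.univ.erase κ, |b κ * b l|
            = ∑ l : {l : Fin G₀.card // κ ≠ l}, |b κ * b l| :=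
          Finset.sum_subtype _ (by simp [eq_comm]) _
        rw [this]
        let φ : {l : Fin G₀.card // κ ≠ l} ↪ {p : Fin G₀.card × Fin G₀.card // p.1 ≠ p.2} :=
          ⟨fun l => ⟨(κ, l.1), l.2⟩, fun _ _ h => by simpa [Subtype.ext_iff] using h⟩
        refine (Finset.sum_map Finset.univ φ fun p => |b p.1.1 * b p.1.2|).symm.trans_le ?_
        exact Finset.sum_le_sum_of_subset_of_nonneg (Finset.subset_univ _)
          fun p _ _ => abs_nonneg _
      have h2 : 1 / (2 * n) * L ≤ E := by
        refine le_trans ?_ h1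
        rw [hL, Finset.mul_sum]
        refine Finset.sum_le_sum fun l _ => ?_
        rw [abs_mul]
        exact mul_le_mul_of_nonneg_right (hκ.trans (le_abs_self _)) (abs_nonneg _)
      rwa [one_div, inv_mul_le_iff₀ (by positivity)] at h2
    have hbκ : |b κ - 1| ≤ L + P := by
      have h1 : b κ - 1 = -(∑ l ∈ Finset.univ.erase κ, b l)
          - ∑ v, defect G₀ β (Sum.inl v) θ := by
        rw [← Finset.add_sum_erase _ _ (Finset.mem_univ κ)] at hsum
        linarith
      rw [h1]
      refine (abs_sub _ _).trans (add_le_add ?_ hPsum)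
      rw [abs_neg]
      exact Finset.abs_sum_le_sum_abs _ _
    refine ⟨κ, (pi_norm_le_iff_of_nonneg (by positivity)).mpr fun v => ?_⟩
    have h1 : (θ - G₀.topic κ) v = G₀.topic κ v * (b κ - 1)
        + ∑ l ∈ Finset.univ.erase κ, G₀.topic l v * b l + defect G₀ β (Sum.inl v) θ := by
      rw [Pi.sub_apply, hdecomp v, ← Finset.add_sum_erase _ _ (Finset.mem_univ κ)]
      ring
    have hle : ∀ l (x : ℝ), |G₀.topic l v * x| ≤ |x| := fun l x => by
      obtain ⟨h0, h1⟩ := mem_Icc_of_mem_stdSimplex (G₀.topic_mem l) v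
      rw [abs_mul, abs_of_nonneg h0]
      exact mul_le_of_le_one_left (abs_nonneg _) h1
    have h2 : |∑ l ∈ Finset.univ.erase κ, G₀.topic l v * b l| ≤ L :=
      (Finset.abs_sum_le_sum_abs _ _).trans (Finset.sum_le_sum fun l _ => hle l _)
    have h3 : |defect G₀ β (Sum.inl v) θ| ≤ P :=
      Finset.single_le_sum (f := fun v => |defect G₀ β (Sum.inl v) θ|)
        (fun _ _ => abs_nonneg _) (Finset.mem_univ v)
    rw [h1, Real.norm_eq_abs]
    have h4 := abs_add_le (G₀.topic κ v * (b κ - 1)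
        + ∑ l ∈ Finset.univ.erase κ, G₀.topic l v * b l) (defect G₀ β (Sum.inl v) θ)
    have h5 := abs_add_le (G₀.topic κ v * (b κ - 1))
        (∑ l ∈ Finset.univ.erase κ, G₀.topic l v * b l)
    nlinarith [hle κ (b κ - 1), mul_nonneg hn0.le hP0]

lemma abs_dotProduct_le_sum_mul_norm (x β : Fin V → ℝ) : |x ⬝ᵥ β| ≤ (∑ v, |β v|) * ‖x‖ := by
  rw [Finset.sum_mul]
  refine (Finset.abs_sum_le_sum_abs _ _).trans (Finset.sum_le_sum fun v _ => ?_)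
  rw [abs_mul, mul_comm]
  exact mul_le_mul_of_nonneg_left (norm_le_pi_norm x v) (abs_nonneg _)

lemma IsDualFamily.exists_lipschitz {G₀ : MixingMeasure V} {β : Fin G₀.card → Fin V → ℝ}
    (hβ : IsDualFamily G₀ β) : ∃ B, 0 ≤ B ∧ (∀ k, ∀ θ ∈ stdSimplex ℝ (Fin V), |θ ⬝ᵥ β k| ≤ B) ∧
      ∀ θ k l, |θ ⬝ᵥ β k - if l = k then 1 else 0| ≤ B * ‖θ - G₀.topic l‖ := by
  have hle : ∀ k, ∑ v, |β k v| ≤ ∑ k, ∑ v, |β k v| := fun k =>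
    Finset.single_le_sum (f := fun k => ∑ v, |β k v|)
      (fun k _ => Finset.sum_nonneg fun v _ => abs_nonneg _) (Finset.mem_univ k)
  refine ⟨∑ k, ∑ v, |β k v|, by positivity, fun k θ hθ => ?_, fun θ k l => ?_⟩
  · refine abs_dotProduct_le_of_mem_stdSimplex hθ fun v => le_trans ?_ (hle k)
    exact Finset.single_le_sum (f := fun v => |β k v|) (fun v _ => abs_nonneg _)
      (Finset.mem_univ v)
  · rw [← hβ k l, ← sub_dotProduct]
    exact (abs_dotProduct_le_sum_mul_norm _ _).trans
      (mul_le_mul_of_nonneg_right (hle k) (norm_nonneg _))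

/-- For linearly independent atoms the squared defects have degree at most four and dominate the
squared distance to the nearest atom, while the cubic `3 x² - 2 x³` turns the dual forms into
indicators of the atoms up to second order. -/
theorem IsDualFamily.inverseBound_two {a : ℝ} (ha : 0 < a) {G₀ : MixingMeasure V}
    {β : Fin G₀.card → Fin V → ℝ} (hβ : IsDualFamily G₀ β) (𝒢 : Set (MixingMeasure V)) :
    InverseBound a G₀ 4 2 𝒢 := by
  obtain ⟨B, hB0, hBb, hB⟩ := hβ.exists_lipschitz
  have hg : ∀ k, Controlled a G₀ 4 fun θ => 3 * (θ ⬝ᵥ β k) ^ 2 + -2 * (θ ⬝ᵥ β k) ^ 3 := fun k => by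
    have h2 := controlled_prod ha G₀ (show 2 ≤ 4 by norm_num) fun _ => β k
    have h3 := controlled_prod ha G₀ (show 3 ≤ 4 by norm_num) fun _ => β k
    simp only [Finset.prod_const, Finset.card_univ, Fintype.card_fin] at h2 h3
    exact (h2.const_mul 3).add (h3.const_mul (-2))
  have hgB : ∀ θ ∈ stdSimplex ℝ (Fin V), ∀ k l,
      |(3 * (θ ⬝ᵥ β k) ^ 2 + -2 * (θ ⬝ᵥ β k) ^ 3) - if l = k then 1 else 0|
        ≤ B ^ 2 * (3 + 2 * B) * ‖θ - G₀.topic l‖ ^ 2 := fun θ hθ k l => by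
    have h1 := hB θ k l
    obtain ⟨hb1, hb2⟩ := abs_le.mp (hBb k θ hθ)
    set x := θ ⬝ᵥ β k
    have key : ∀ y z : ℝ, |y| ≤ B * ‖θ - G₀.topic l‖ → |z| ≤ 3 + 2 * B →
        |y ^ 2 * z| ≤ B ^ 2 * (3 + 2 * B) * ‖θ - G₀.topic l‖ ^ 2 := fun y z hy hz => by
      rw [abs_mul, abs_pow]
      calc |y| ^ 2 * |z| ≤ (B * ‖θ - G₀.topic l‖) ^ 2 * (3 + 2 * B) := by gcongr
        _ = _ := by ring
    split_ifs at h1 ⊢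
    · have : 3 * x ^ 2 + -2 * x ^ 3 - 1 = (x - 1) ^ 2 * (-1 - 2 * x) := by ring
      rw [this]
      exact key _ _ h1 (by rw [abs_le]; constructor <;> linarith)
    · have : 3 * x ^ 2 + -2 * x ^ 3 - 0 = (x - 0) ^ 2 * (3 - 2 * x) := by ring
      rw [this]
      exact key _ _ h1 (by rw [abs_le]; constructor <;> linarith)
  obtain ⟨A, hA, hdist⟩ := exists_norm_sub_le_sum_defect G₀ β
  have hf : Controlled a G₀ 4 fun θ => ∑ j, defect G₀ β j θ ^ 2 := by
    refine Controlled.finsetSum _ fun j _ => ?_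
    rcases j with v | p
    · have := controlled_prod ha G₀ (show 2 ≤ 4 by norm_num)
        fun _ => Pi.single v 1 - ∑ k, G₀.topic k v • β k
      simpa [defect] using this
    · have := controlled_prod ha G₀ le_rfl ![β p.1.1, β p.1.2, β p.1.1, β p.1.2]
      refine (congrArg _ (funext fun θ => ?_)).mp this
      simp only [Fin.prod_univ_four, defect, Sum.elim_inr]
      simp
      ring
  obtain ⟨C, hC, hfC⟩ := hf
  have hf0 : G₀.integral (fun θ => ∑ j, defect G₀ β j θ ^ 2) = 0 := by
    refine Finset.sum_eq_zero fun k _ => ?_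
    simp [hβ.defect_topic]
  choose! κ hκ using hdist
  set M : ℝ := A ^ 2 * Fintype.card (Fin V ⊕ {p : Fin G₀.card × Fin G₀.card // p.1 ≠ p.2})
  refine inverseBound_of_clusterCost_le two_ne_zero hg hgB one_pos (C := M * C)
    fun G _ _ => ⟨fun i => κ (G.topic i), ?_⟩
  have h := hfC G
  rw [hf0, sub_zero] at h
  rw [mul_assoc]
  refine le_trans ?_ (mul_le_mul_of_nonneg_left ((le_abs_self _).trans h) (by positivity))
  rw [clusterCost, MixingMeasure.integral, Finset.mul_sum]
  refine Finset.sum_le_sum fun i _ => ?_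
  rw [mul_left_comm]
  refine mul_le_mul_of_nonneg_left ?_ (G.weight_pos i).le
  calc ‖G.topic i - G₀.topic (κ (G.topic i))‖ ^ 2
      ≤ (A * ∑ j, |defect G₀ β j (G.topic i)|) ^ 2 :=
        pow_le_pow_left₀ (norm_nonneg _) (hκ _ (G.topic_mem i)) 2
    _ = A ^ 2 * (∑ j, |defect G₀ β j (G.topic i)|) ^ 2 := mul_pow _ _ _
    _ ≤ A ^ 2 * (Fintype.card (Fin V ⊕ {p : Fin G₀.card × Fin G₀.card // p.1 ≠ p.2})
        * ∑ j, |defect G₀ β j (G.topic i)| ^ 2) :=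
        mul_le_mul_of_nonneg_left sq_sum_le_card_mul_sum_sq (by positivity)
    _ = M * ∑ j, defect G₀ β j (G.topic i) ^ 2 := by
        simp only [sq_abs]
        ring

lemma MixingMeasure.sq_integral_abs_le (G : MixingMeasure V) (h : (Fin V → ℝ) → ℝ) :
    G.integral (fun θ => |h θ|) ^ 2 ≤ G.integral fun θ => h θ ^ 2 := by
  set m := G.integral fun θ => |h θ| with hm
  have h1 : 0 ≤ ∑ i, G.weight i * (|h (G.topic i)| - m) ^ 2 :=
    Finset.sum_nonneg fun i _ => mul_nonneg (G.weight_pos i).le (sq_nonneg _)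
  have h2 : ∑ i, G.weight i * (|h (G.topic i)| - m) ^ 2
      = G.integral (fun θ => h θ ^ 2) - 2 * m * m + (∑ i, G.weight i) * m ^ 2 := by
    nth_rewrite 3 [hm]
    simp only [MixingMeasure.integral, Finset.mul_sum, Finset.sum_mul,
      ← Finset.sum_sub_distrib, ← Finset.sum_add_distrib]
    refine Finset.sum_congr rfl fun i _ => ?_
    rw [← sq_abs (h (G.topic i))]
    ring
  rw [G.weight_sum] at h2
  nlinarith

/-- If `G` has as many atoms as `G₀` and the law of documents of length two is close to that of
`G₀`, then the forms `βₘ` are a nearly orthogonal basis of `L²(G)`. Hence the `L²(G)` norm of a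
function which vanishes at the atoms of `G₀` is controlled by its correlations with these forms. -/
theorem IsDualFamily.exists_integral_abs_le {a : ℝ} (ha : 0 < a) {G₀ : MixingMeasure V}
    {β : Fin G₀.card → Fin V → ℝ} (hβ : IsDualFamily G₀ β) {N : ℕ} (hN : 2 ≤ N) :
    ∃ δ, 0 < δ ∧ ∀ h : (Fin V → ℝ) → ℝ,
      (∀ m, Controlled a G₀ N fun θ => h θ * (θ ⬝ᵥ β m)) → (∀ k, h (G₀.topic k) = 0) →
      ∃ C, 0 ≤ C ∧ ∀ G : MixingMeasure V, G.card = G₀.card → docDist a G₀ N G < δ →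
        G.integral (fun θ => |h θ|) ≤ C * docDist a G₀ N G := by
  obtain ⟨ω, hω, -, hω'⟩ := exists_pos_le_one_forall_le G₀.weight_pos
  have hpair : ∀ m m', Controlled a G₀ N fun θ => (θ ⬝ᵥ β m) * (θ ⬝ᵥ β m') := fun m m' => by
    have := controlled_prod ha G₀ hN ![β m, β m']
    simpa using this
  choose c hc hcb using hpair
  set S := ∑ m, ∑ m', c m m'
  have hS : 0 ≤ S := Finset.sum_nonneg fun m _ => Finset.sum_nonneg fun m' _ => hc m m'
  have hcS : ∀ m m', c m m' ≤ S := fun m m' =>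
    (Finset.single_le_sum (f := c m) (fun m' _ => hc m m') (Finset.mem_univ m')).trans
      (Finset.single_le_sum (f := fun m => ∑ m', c m m')
        (fun m _ => Finset.sum_nonneg fun m' _ => hc m m') (Finset.mem_univ m))
  obtain ⟨n, hn⟩ : ∃ n : ℝ, n = G₀.card := ⟨_, rfl⟩
  have hn0 : 0 < n := by rw [hn]; exact_mod_cast G₀.card_pos
  refine ⟨ω / (2 * (S * n + 1)), by positivity, fun h hh h0 => ?_⟩
  choose e he heb using hh
  set E := ∑ m, e m
  have hE : 0 ≤ E := Finset.sum_nonneg fun m _ => he m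
  have heE : ∀ m, e m ≤ E := fun m => Finset.single_le_sum (fun m _ => he m) (Finset.mem_univ m)
  refine ⟨√(2 * n / ω) * E, by positivity, fun G hG hd => ?_⟩
  set D := docDist a G₀ N G
  have hD : 0 ≤ D := docDist_nonneg a G₀ N G
  have hDω : S * n * D ≤ ω / 2 := by
    rw [lt_div_iff₀ (by positivity)] at hd
    nlinarith
  -- the quadratic form of the Gram matrix of the `βₘ` in `L²(G)` is bounded below
  have hgram : ∀ x : Fin G₀.card → ℝ, ω / 2 * ∑ m, x m ^ 2
      ≤ ∑ i, G.weight i * (∑ m, x m * (G.topic i ⬝ᵥ β m)) ^ 2 := fun x => by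
    have e1 : ∑ i, G.weight i * (∑ m, x m * (G.topic i ⬝ᵥ β m)) ^ 2
        = ∑ m, ∑ m', x m * x m' * G.integral fun θ => (θ ⬝ᵥ β m) * (θ ⬝ᵥ β m') := by
      have e : ∀ i, G.weight i * (∑ m, x m * (G.topic i ⬝ᵥ β m)) ^ 2 = ∑ m, ∑ m',
          x m * x m' * (G.weight i * ((G.topic i ⬝ᵥ β m) * (G.topic i ⬝ᵥ β m'))) := fun i => by
        rw [sq, Finset.sum_mul_sum, Finset.mul_sum]
        refine Finset.sum_congr rfl fun m _ => ?_
        rw [Finset.mul_sum]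
        exact Finset.sum_congr rfl fun m' _ => by ring
      simp only [e, MixingMeasure.integral, Finset.mul_sum]
      rw [Finset.sum_comm]
      exact Finset.sum_congr rfl fun m _ => Finset.sum_comm
    have e0 : ∀ m m', G₀.integral (fun θ => (θ ⬝ᵥ β m) * (θ ⬝ᵥ β m'))
        = if m = m' then G₀.weight m else 0 := fun m m' => by
      rcases eq_or_ne m m' with rfl | hne
      · simp [MixingMeasure.integral, hβ _ _]
      · simp [MixingMeasure.integral, hβ _ _, hne, hne.symm]
    have e2 : ∑ m, G₀.weight m * x m ^ 2
        = ∑ m, ∑ m', x m * x m' * G₀.integral fun θ => (θ ⬝ᵥ β m) * (θ ⬝ᵥ β m') := by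
      simp only [e0, mul_ite, mul_zero, Finset.sum_ite_eq, Finset.mem_univ, if_true]
      exact Finset.sum_congr rfl fun m _ => by ring
    have e3 : ∑ m, G₀.weight m * x m ^ 2
        - ∑ i, G.weight i * (∑ m, x m * (G.topic i ⬝ᵥ β m)) ^ 2
        ≤ S * D * (∑ m, |x m|) ^ 2 := by
      rw [e1, e2, sq, Finset.sum_mul_sum, Finset.mul_sum, ← Finset.sum_sub_distrib]
      refine Finset.sum_le_sum fun m _ => ?_
      rw [Finset.mul_sum, ← Finset.sum_sub_distrib]
      refine Finset.sum_le_sum fun m' _ => ?_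
      rw [← mul_sub]
      refine (le_abs_self _).trans ?_
      rw [abs_mul, abs_mul, abs_sub_comm, mul_comm (S * D)]
      refine mul_le_mul_of_nonneg_left ((hcb m m' G).trans ?_) (by positivity)
      exact mul_le_mul_of_nonneg_right (hcS m m') hD
    have e4 : (∑ m, |x m|) ^ 2 ≤ n * ∑ m, x m ^ 2 := by
      have := sq_sum_le_card_mul_sum_sq (s := Finset.univ) (f := fun m => |x m|)
      simpa [hn] using this
    have e5 : ω * ∑ m, x m ^ 2 ≤ ∑ m, G₀.weight m * x m ^ 2 := by
      rw [Finset.mul_sum]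
      exact Finset.sum_le_sum fun m _ => mul_le_mul_of_nonneg_right (hω' m) (sq_nonneg _)
    have hX : 0 ≤ ∑ m, x m ^ 2 := Finset.sum_nonneg fun m _ => sq_nonneg _
    have e6 : S * D * (∑ m, |x m|) ^ 2 ≤ ω / 2 * ∑ m, x m ^ 2 := by
      refine (mul_le_mul_of_nonneg_left e4 (by positivity)).trans ?_
      calc S * D * (n * ∑ m, x m ^ 2) = S * n * D * ∑ m, x m ^ 2 := by ring
        _ ≤ _ := mul_le_mul_of_nonneg_right hDω hX
    linarith
  let L : (Fin G₀.card → ℝ) →ₗ[ℝ] (Fin G.card → ℝ) :=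
    (Matrix.of fun i m => G.topic i ⬝ᵥ β m).mulVecLin
  have hL : ∀ x i, L x i = ∑ m, x m * (G.topic i ⬝ᵥ β m) := fun x i => by
    simp only [L, Matrix.mulVecLin_apply, Matrix.mulVec, Matrix.of_apply]
    rw [dotProduct_comm]
    rfl
  have hLinj : Function.Injective L := by
    rw [← LinearMap.ker_eq_bot, LinearMap.ker_eq_bot']
    intro x hx
    have h1 := hgram x
    simp only [← hL, hx, Pi.zero_apply] at h1
    simp only [ne_eq, OfNat.ofNat_ne_zero, not_false_eq_true, zero_pow, mul_zero,
      Finset.sum_const_zero] at h1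
    have hX : 0 ≤ ∑ m, x m ^ 2 := Finset.sum_nonneg fun m _ => sq_nonneg _
    have h2 : ∑ m, x m ^ 2 = 0 := by nlinarith
    funext m
    have := (Finset.sum_eq_zero_iff_of_nonneg fun m _ => sq_nonneg (x m)).mp h2 m
      (Finset.mem_univ m)
    simpa using this
  have hLsurj : Function.Surjective L :=
    (LinearMap.injective_iff_surjective_of_finrank_eq_finrank (by simp [hG])).mp hLinj
  -- by equality of dimensions, `h` is a combination of the `βₘ` on the atoms of `G`
  obtain ⟨x, hx⟩ := hLsurj fun i => h (G.topic i)
  have hx' : ∀ i, ∑ m, x m * (G.topic i ⬝ᵥ β m) = h (G.topic i) := fun i => by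
    rw [← hL, hx]
  have hHx := hgram x
  simp only [hx'] at hHx
  set H := G.integral fun θ => h θ ^ 2 with hH
  have hHx' : ω / 2 * ∑ m, x m ^ 2 ≤ H := hHx
  have hH0 : 0 ≤ H := Finset.sum_nonneg fun i _ => mul_nonneg (G.weight_pos i).le (sq_nonneg _)
  have hHy : H ≤ (∑ m, |x m|) * (E * D) := by
    have e1 : H = ∑ m, x m * G.integral fun θ => h θ * (θ ⬝ᵥ β m) := by
      simp only [hH, MixingMeasure.integral, Finset.mul_sum]
      rw [Finset.sum_comm]
      refine Finset.sum_congr rfl fun i _ => ?_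
      rw [sq]
      nth_rewrite 1 [← hx' i]
      rw [Finset.sum_mul, Finset.mul_sum]
      exact Finset.sum_congr rfl fun m _ => by ring
    rw [e1, Finset.sum_mul]
    refine Finset.sum_le_sum fun m _ => (le_abs_self _).trans ?_
    rw [abs_mul]
    refine mul_le_mul_of_nonneg_left ?_ (abs_nonneg _)
    have := heb m G
    have hz : G₀.integral (fun θ => h θ * (θ ⬝ᵥ β m)) = 0 :=
      Finset.sum_eq_zero fun k _ => by simp [h0]
    rw [hz, sub_zero] at this
    exact this.trans (mul_le_mul_of_nonneg_right (heE m) hD)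
  have hHfin : H ≤ 2 * n / ω * (E * D) ^ 2 := by
    have e4 : (∑ m, |x m|) ^ 2 ≤ n * ∑ m, x m ^ 2 := by
      have := sq_sum_le_card_mul_sum_sq (s := Finset.univ) (f := fun m => |x m|)
      simpa [hn] using this
    have e5 : H ^ 2 ≤ 2 * n / ω * (E * D) ^ 2 * H := by
      calc H ^ 2 ≤ ((∑ m, |x m|) * (E * D)) ^ 2 := pow_le_pow_left₀ hH0 hHy 2
        _ = (∑ m, |x m|) ^ 2 * (E * D) ^ 2 := mul_pow _ _ _
        _ ≤ (n * ∑ m, x m ^ 2) * (E * D) ^ 2 := mul_le_mul_of_nonneg_right e4 (sq_nonneg _)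
        _ = 2 * n / ω * (E * D) ^ 2 * (ω / 2 * ∑ m, x m ^ 2) := by field_simp
        _ ≤ _ := mul_le_mul_of_nonneg_left hHx' (by positivity)
    rcases hH0.eq_or_lt with hz | hz
    · rw [← hz]; positivity
    · rw [sq] at e5
      exact le_of_mul_le_mul_right e5 hz
  refine le_of_sq_le_sq ?_ (by positivity)
  refine (G.sq_integral_abs_le h).trans (hHfin.trans_eq ?_)
  rw [mul_assoc, mul_pow √(2 * n / ω), Real.sq_sqrt (by positivity)]

/-- The first order inverse bound follows from control of the `L¹(G)` norms of the defects. -/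
theorem IsDualFamily.inverseBound_one {a : ℝ} (ha : 0 < a) {G₀ : MixingMeasure V}
    {β : Fin G₀.card → Fin V → ℝ} (hβ : IsDualFamily G₀ β) {N : ℕ} (hN : 1 ≤ N) {δ : ℝ}
    (hδ : 0 < δ) (h : ∀ j, ∃ C, 0 ≤ C ∧ ∀ G : MixingMeasure V, G.card = G₀.card →
      docDist a G₀ N G < δ → G.integral (fun θ => |defect G₀ β j θ|) ≤ C * docDist a G₀ N G) :
    InverseBound a G₀ N 1 (exactAtoms V G₀.card) := by
  obtain ⟨B, hB0, -, hB⟩ := hβ.exists_lipschitz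
  obtain ⟨A, hA, hdist⟩ := exists_norm_sub_le_sum_defect G₀ β
  choose! κ hκ using hdist
  choose C hC hCb using h
  have hg : ∀ k, Controlled a G₀ N fun θ => θ ⬝ᵥ β k := fun k => by
    simpa using controlled_prod ha G₀ hN fun _ => β k
  refine inverseBound_of_clusterCost_le one_ne_zero hg (B := B)
    (fun θ _ k l => by simpa only [pow_one] using hB θ k l) hδ (C := A * ∑ j, C j)
    fun G hG hd => ⟨fun i => κ (G.topic i), ?_⟩
  calc clusterCost 1 G G₀ (fun i => κ (G.topic i))
      ≤ ∑ i, G.weight i * (A * ∑ j, |defect G₀ β j (G.topic i)|) := by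
        refine Finset.sum_le_sum fun i _ => mul_le_mul_of_nonneg_left ?_ (G.weight_pos i).le
        rw [pow_one]
        exact hκ _ (G.topic_mem i)
    _ = A * ∑ j, G.integral fun θ => |defect G₀ β j θ| := by
        rw [← G.integral_finsetSum, ← G.integral_const_mul]
        rfl
    _ ≤ A * ∑ j, C j * docDist a G₀ N G :=
        mul_le_mul_of_nonneg_left (Finset.sum_le_sum fun j _ => hCb j G hG hd) hA
    _ = _ := by rw [← Finset.sum_mul, mul_assoc]

theorem IsDualFamily.inverseBound_one_three {a : ℝ} (ha : 0 < a) {G₀ : MixingMeasure V}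
    {β : Fin G₀.card → Fin V → ℝ} (hβ : IsDualFamily G₀ β) :
    InverseBound a G₀ 3 1 (exactAtoms V G₀.card) := by
  obtain ⟨δ, hδ, h⟩ := hβ.exists_integral_abs_le ha (show 2 ≤ 3 by norm_num)
  refine hβ.inverseBound_one ha (by norm_num) hδ fun j =>
    h (defect G₀ β j) (fun m => ?_) (hβ.defect_topic j)
  rcases j with v | p
  · have := controlled_prod ha G₀ (show 2 ≤ 3 by norm_num)
      ![Pi.single v 1 - ∑ k, G₀.topic k v • β k, β m]
    simp only [Fin.prod_univ_two] at this
    exact this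
  · have := controlled_prod ha G₀ le_rfl ![β p.1.1, β p.1.2, β m]
    simp only [Fin.prod_univ_three] at this
    exact this

/-- With anchor words the products `⟨θ, βₖ⟩ ⟨θ, βₗ⟩` are nonnegative on the simplex, so that their
`L¹(G)` norms are moments of degree two. -/
theorem AnchorWord.inverseBound_one_two {a : ℝ} (ha : 0 < a) {G₀ : MixingMeasure V}
    (hG₀ : AnchorWord G₀) : InverseBound a G₀ 2 1 (exactAtoms V G₀.card) := by
  obtain ⟨β, hβ, hnn⟩ := hG₀.exists_isDualFamily
  obtain ⟨δ, hδ, h⟩ := hβ.exists_integral_abs_le ha le_rfl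
  refine hβ.inverseBound_one ha one_le_two hδ fun j => ?_
  have h0 := hβ.defect_topic j
  rcases j with v | p
  · refine h _ (fun m => ?_) h0
    have := controlled_prod ha G₀ le_rfl ![Pi.single v 1 - ∑ k, G₀.topic k v • β k, β m]
    simp only [Fin.prod_univ_two] at this
    exact this
  · have hc := controlled_prod ha G₀ le_rfl ![β p.1.1, β p.1.2]
    simp only [Fin.prod_univ_two] at hc
    obtain ⟨C, hC, hCb⟩ := hc
    refine ⟨C, hC, fun G _ _ => ?_⟩
    have e1 : G.integral (fun θ => |defect G₀ β (Sum.inr p) θ|)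
        = G.integral (defect G₀ β (Sum.inr p)) :=
      Finset.sum_congr rfl fun i _ => by
        simp only [defect, Sum.elim_inr]
        rw [abs_of_nonneg (mul_nonneg (hnn _ _ (G.topic_mem i)) (hnn _ _ (G.topic_mem i)))]
    have e2 : G₀.integral (defect G₀ β (Sum.inr p)) = 0 :=
      Finset.sum_eq_zero fun k _ => by rw [h0, mul_zero]
    have := hCb G
    change |G.integral (defect G₀ β (Sum.inr p)) - G₀.integral (defect G₀ β (Sum.inr p))| ≤ _
      at this
    rw [e2, sub_zero] at this
    rw [e1]
    exact (le_abs_self _).trans this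

/-! ### Minimal document lengths -/

lemma InverseBound.mono {a : ℝ} {G₀ : MixingMeasure V} {N r : ℕ} {𝒢 𝒢' : Set (MixingMeasure V)}
    (h : InverseBound a G₀ N r 𝒢) (hsub : 𝒢' ⊆ 𝒢) : InverseBound a G₀ N r 𝒢' := by
  obtain ⟨c, hc, h⟩ := h
  exact ⟨c, hc, fun G hG => h G (hsub hG)⟩

end LDA

end

theorem theorem3 {V : ℕ} (a : ℝ) (ha : 0 < a) {K₀ : ℕ} (G₀ : LDA.MixingMeasure V)
    (hG₀ : G₀ ∈ LDA.exactAtoms V K₀) :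
    (LDA.minLength₁ a G₀ ≤ ((2 * K₀ - 1 : ℕ) : ℕ∞) ∧
      ∀ K : ℕ, K₀ ≤ K → LDA.minLength₂ a G₀ K ≤ ((K₀ + K - 1 : ℕ) : ℕ∞)) ∧
    (LinearIndependent ℝ G₀.topic →
      LDA.minLength₁ a G₀ ≤ 3 ∧ LDA.minLength₂All a G₀ ≤ 4) ∧
    (LDA.AnchorWord G₀ → LDA.minLength₁ a G₀ ≤ 2) := by
  obtain rfl : G₀.card = K₀ := hG₀
  have hpos := G₀.card_pos
  refine ⟨⟨?_, fun K hK => ?_⟩, fun hli => ?_, fun hanchor => ?_⟩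
  · refine sInf_le ⟨_, ⟨by omega, ?_⟩, rfl⟩
    exact (LDA.inverseBound_one_of_card_le ha G₀).mono fun G hG => le_of_eq hG
  · refine sInf_le ⟨_, ⟨by omega, ?_⟩, rfl⟩
    rcases hK.eq_or_lt with rfl | hlt
    · rw [← two_mul]
      exact (LDA.inverseBound_two_of_card_le ha G₀).mono fun G hG => hG.2
    · exact LDA.inverseBound_two_of_two_mul_card_le ha G₀ (by omega) _
  · obtain ⟨β, hβ⟩ := LDA.exists_isDualFamily hli
    exact ⟨sInf_le ⟨3, ⟨by norm_num, hβ.inverseBound_one_three ha⟩, rfl⟩,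
      sInf_le ⟨4, ⟨by norm_num, fun K _ => hβ.inverseBound_two ha _⟩, rfl⟩⟩
  · exact sInf_le ⟨2, ⟨by norm_num, hanchor.inverseBound_one_two ha⟩, rfl⟩
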